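/- **Definitions.** The *whirl graph* $G=(V,E)$ has vertex set $V=\bigcup_{n\ge 1}V_n$ with $V_n=\{\frac{k}{3^n} : 0\le k\le 3^n\}$ and edge set $E=\bigcup_{n\ge1}E_n$, where $$E_n=\Big\{\big\{\tfrac{3k}{3^n},\tfrac{3k+2}{3^n}\big\},\ \big\{\tfrac{3k+1}{3^n},\tfrac{3k+2}{3^n}\big\},\ \big\{\tfrac{3k+1}{3^n},\tfrac{3k+3}{3^n}\big\} : 0\le k\le 3^{n-1}-1\Big\}.$$ The *halved Farey graph of order $0$*, $\check F_0$, is a $K^2$ whose only edge is coloured blue. The edge-coloured graph $\check F_{n+1}$ arises from $\check F_n$ by adding a new vertex $v_e$ for every blue edge $e$ of $\check F_n$, joining each $v_e$ precisely to the two endvertices of $e$ by two blue edges, and recolouring all edges of $\check F_n$ black. The *halved Farey graph* is $\check F=\bigcup_n\check F_n$ (without colours), and the *Farey graph* $F$ is the union of two copies of $\check F$ that meet precisely in $\check F_0$. Let $\mathcal C_0=\{[0,1]\}$, and let $\mathcal C_{n+1}$ arise from $\mathcal C_n$ by replacing each interval $[a,a+\Delta]$ with $[a,a+\frac13\Delta]$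 and $[a+\frac23\Delta,a+\Delta]$. Let $G^*$ be the graph whose vertices are the numbers $a,\ a+\frac13\Delta,\ a+\frac23\Delta,\ a+\Delta$ and whose edges are $\{a,a+\frac23\Delta\}$, $\{a+\frac13\Delta,a+\frac23\Delta\}$, $\{a+\frac13\Delta,a+\Delta\}$, for all $[a,a+\Delta]\in\bigcup_{n\ge0}\mathcal C_n$. Let $M$ be the set of all the edges $\{a+\frac13\Delta,a+\frac23\Delta\}$. Let $\pi_1(x)=\frac19x+\frac39$ and $\pi_2(x)=\frac19x+\frac59$, and write $\pi_iG^*$, $\pi_iM$ for the graph and the edge set obtained by renaming every vertex $v$ to $\pi_i(v)$. For a graph $H$ and an independent set $D$ of edges (no two of which share an endvertex), $H/D$ is the graph obtained from $H$ by contracting the edges in $D\cap E(H)$; its vertices are the components of $(V(H),D\cap E(H))$, whose vertex sets are the branch sets. **Theorem 2.** The whirl graph $G$ contains the Farey graph $F$ as a minor with all branch sets of size two. Explicitly, let $$H=\pi_1G^*\cup\pi_2G^*+\{\tfrac39,\tfrac59\}+\{\tfrac49,\tfrac69\}+\{\tfrac39,\tfrac69\},\qquad D=\pi_1M\cup\pi_2M+\{\tfrac39,\tfrac59\}+\{\tfrac49,\tfrac69\}.$$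 Then $H$ is a subgraph of $G$, $D$ is an independent set of edges of $H$, every branch set of $H/D$ has exactly two elements, and $$F\cong H/D .$$ However, $G$ does not contain $F$ as a topological minor, i.e. no subgraph of $G$ is a subdivision of $F$. -/

import Mathlib

/-! ### Graphs whose vertices are rational numbers -/

/-- A graph `H` with `V(H) ⊆ ℚ`, as a subgraph of the complete graph on `ℚ`.  Thus `H ≤ K` is the
subgraph relation and `H ⊔ K` is the union `H ∪ K`. -/
abbrev RatGraph : Type := (⊤ : SimpleGraph ℚ).Subgraph

/-- The graph with vertex set `W` and edge set `E` (where `E` consists of 2-element subsets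
of `W`; other members of `E` are ignored). -/
def graphOn (W : Set ℚ) (E : Set (Sym2 ℚ)) : RatGraph where
  verts := W
  Adj u v := u ∈ W ∧ v ∈ W ∧ u ≠ v ∧ s(u, v) ∈ E
  adj_sub h := h.2.2.1
  edge_vert h := h.1
  symm := ⟨fun _ _ h => ⟨h.2.1, h.1, h.2.2.1.symm, Sym2.eq_swap ▸ h.2.2.2⟩⟩

/-- The graph obtained from `H` by adding the edges in `D` between vertices of `H`. -/
def addEdges (H : RatGraph) (D : Set (Sym2 ℚ)) : RatGraph :=
  graphOn H.verts (H.edgeSet ∪ D)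

/-- The graph `π H` obtained from `H` by renaming every vertex `v` to `π v`. -/
def permGraph (π : Equiv.Perm ℚ) (H : RatGraph) : RatGraph :=
  H.map (SimpleGraph.Iso.completeGraph π).toHom

/-- The edge set `π D` obtained from `D` by renaming every vertex `v` to `π v`. -/
def permEdges (π : Equiv.Perm ℚ) (D : Set (Sym2 ℚ)) : Set (Sym2 ℚ) :=
  Sym2.map π '' D

/-- An independent set of edges: no two of them have an endvertex in common. -/
def IndependentEdges (D : Set (Sym2 ℚ)) : Prop :=
  ∀ e ∈ D, ∀ f ∈ D, e ≠ f → ∀ v, v ∈ e → v ∉ f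

/-! ### The whirl graph -/

/-- `V_n = {0/3^n, 1/3^n, …, 3^n/3^n}`. -/
def whirlVerts (n : ℕ) : Set ℚ :=
  {q | ∃ k : ℕ, k ≤ 3 ^ n ∧ q = (k : ℚ) / 3 ^ n}

/-- `E_n`, for `n ≥ 1`. -/
def whirlEdges (n : ℕ) : Set (Sym2 ℚ) :=
  {e | ∃ k : ℕ, k < 3 ^ (n - 1) ∧
    (e = s((3 * k : ℚ) / 3 ^ n, (3 * k + 2 : ℚ) / 3 ^ n) ∨
     e = s((3 * k + 1 : ℚ) / 3 ^ n, (3 * k + 2 : ℚ) / 3 ^ n) ∨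
     e = s((3 * k + 1 : ℚ) / 3 ^ n, (3 * k + 3 : ℚ) / 3 ^ n))}

/-- The whirl graph: `V = ⋃_{n ≥ 1} V_n` and `E = ⋃_{n ≥ 1} E_n`. -/
def whirlGraph : RatGraph :=
  graphOn {q | ∃ n, 1 ≤ n ∧ q ∈ whirlVerts n} {e | ∃ n, 1 ≤ n ∧ e ∈ whirlEdges n}

/-! ### The Farey graph -/

/-- Vertices of the halved Farey graph: the two vertices `x`, `y` of the halved Farey graph of
order `0`, and the vertices `v_e`.  The blue edges of the halved Farey graph of order `n` are
indexed by the words `e : List Bool` of length `n`: the empty word is the edge `xy`, and the two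
blue edges that join `v_e` to the endvertices of `e` are `false :: e` and `true :: e`. -/
inductive HalvedFareyVertex : Type
  | x : HalvedFareyVertex
  | y : HalvedFareyVertex
  | new (e : List Bool) : HalvedFareyVertex

/-- The two endvertices of the blue edge indexed by a word. -/
def blueEnds : List Bool → HalvedFareyVertex × HalvedFareyVertex
  | [] => (.x, .y)
  | false :: e => ((blueEnds e).1, .new e)
  | true :: e => (.new e, (blueEnds e).2)

/-- The set of blue edges of the halved Farey graph of order `n`. -/
def blueEdges (n : ℕ) : Set (Sym2 HalvedFareyVertex) :=
  {f | ∃ e : List Bool, e.length = n ∧ f = s((blueEnds e).1, (blueEnds e).2)}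

/-- The halved Farey graph, the union of the halved Farey graphs of all orders.  Every edge of it
is blue in exactly one order, so its edges are all the edges that are blue in some order. -/
def halvedFareyGraph : SimpleGraph HalvedFareyVertex :=
  SimpleGraph.fromEdgeSet (⋃ n, blueEdges n)

/-- Vertices of the Farey graph: the common vertices `x`, `y` of the two copies of the halved
Farey graph, and for each of the two copies its own vertices `v_e`. -/
inductive FareyVertex : Type
  | x : FareyVertex
  | y : FareyVertex
  | new (copy : Bool) (e : List Bool) : FareyVertex

/-- The vertices of the `i`-th copy of the halved Farey graph. -/
def fareyCopy (i : Bool) : HalvedFareyVertex → FareyVertex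
  | .x => .x
  | .y => .y
  | .new e => .new i e

/-- The Farey graph: the union of two copies of the halved Farey graph that meet precisely in the
halved Farey graph of order `0`. -/
def fareyGraph : SimpleGraph FareyVertex :=
  halvedFareyGraph.map (fareyCopy false) ⊔ halvedFareyGraph.map (fareyCopy true)

/-! ### The graph `G*` and the matching `M` -/

/-- `cantorIntervals n` is the collection `𝒞_n` of the intervals in the `n`-th step of the
construction of the Cantor set; the pair `(a, Δ)` stands for `[a, a + Δ]`. -/
def cantorIntervals : ℕ → Set (ℚ × ℚ)
  | 0 => {(0, 1)}
  | n + 1 => {J | ∃ I ∈ cantorIntervals n,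
      J = (I.1, I.2 / 3) ∨ J = (I.1 + 2 / 3 * I.2, I.2 / 3)}

/-- `C_n*`, for `n ≥ 1`. -/
def starVerts (n : ℕ) : Set ℚ :=
  {q | ∃ I ∈ cantorIntervals (n - 1),
    q = I.1 ∨ q = I.1 + 1 / 3 * I.2 ∨ q = I.1 + 2 / 3 * I.2 ∨ q = I.1 + I.2}

/-- `E_n*`, for `n ≥ 1`. -/
def starEdges (n : ℕ) : Set (Sym2 ℚ) :=
  {e | ∃ I ∈ cantorIntervals (n - 1),
    e = s(I.1, I.1 + 2 / 3 * I.2) ∨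
    e = s(I.1 + 1 / 3 * I.2, I.1 + 2 / 3 * I.2) ∨
    e = s(I.1 + 1 / 3 * I.2, I.1 + I.2)}

/-- `M_n`, for `n ≥ 1`. -/
def starMatchingLevel (n : ℕ) : Set (Sym2 ℚ) :=
  {e | ∃ I ∈ cantorIntervals (n - 1), e = s(I.1 + 1 / 3 * I.2, I.1 + 2 / 3 * I.2)}

/-- The graph `G* = (⋃_{n ≥ 1} C_n*, ⋃_{n ≥ 1} E_n*)`. -/
def starGraph : RatGraph :=
  graphOn {q | ∃ n, 1 ≤ n ∧ q ∈ starVerts n} {e | ∃ n, 1 ≤ n ∧ e ∈ starEdges n}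

/-- The matching `M = ⋃_{n ≥ 1} M_n`. -/
def starMatching : Set (Sym2 ℚ) :=
  {e | ∃ n, 1 ≤ n ∧ e ∈ starMatchingLevel n}

/-- The permutation `x ↦ (1/9) x + c` of `ℚ`. -/
def ninthShift (c : ℚ) : Equiv.Perm ℚ where
  toFun x := 1 / 9 * x + c
  invFun y := 9 * (y - c)
  left_inv x := by ring
  right_inv y := by ring

/-- `π₁(x) = (1/9) x + 3/9`. -/
def perm₁ : Equiv.Perm ℚ := ninthShift (3 / 9)

/-- `π₂(x) = (1/9) x + 5/9`. -/
def perm₂ : Equiv.Perm ℚ := ninthShift (5 / 9)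

/-- `π₁G* ∪ π₂G* + {3/9, 5/9} + {4/9, 6/9} + {3/9, 6/9}`. -/
def whirlFareySubgraph : RatGraph :=
  addEdges (permGraph perm₁ starGraph ⊔ permGraph perm₂ starGraph)
    {s(3 / 9, 5 / 9), s(4 / 9, 6 / 9), s(3 / 9, 6 / 9)}

/-- `π₁M ∪ π₂M + {3/9, 5/9} + {4/9, 6/9}`. -/
def whirlFareyMatching : Set (Sym2 ℚ) :=
  permEdges perm₁ starMatching ∪ permEdges perm₂ starMatching ∪
    {s(3 / 9, 5 / 9), s(4 / 9, 6 / 9)}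

/-! ### Contractions, minors and topological minors -/

/-- The spanning subgraph of `H` whose edges are those in `D ∩ E(H)`. -/
def contractedPart (H : RatGraph) (D : Set (Sym2 ℚ)) : SimpleGraph H.verts where
  Adj u v := H.Adj u v ∧ s((u : ℚ), (v : ℚ)) ∈ D
  symm := ⟨fun _ _ h => ⟨h.1.symm, Sym2.eq_swap ▸ h.2⟩⟩
  loopless := ⟨fun _ h => H.loopless.irrefl _ h.1⟩

/-- The contraction minor `H / D`, obtained from `H` by contracting the edges in `D ∩ E(H)`: its
vertices are the components of `(V(H), D ∩ E(H))`, and two distinct ones are adjacent if `H` has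
an edge between them.  The branch set of a vertex `A` of `H / D` is its support `A.supp`. -/
def contract (H : RatGraph) (D : Set (Sym2 ℚ)) :
    SimpleGraph (contractedPart H D).ConnectedComponent where
  Adj A B := A ≠ B ∧ ∃ u ∈ A.supp, ∃ v ∈ B.supp, H.Adj u v
  symm := ⟨fun _ _ ⟨hne, u, hu, v, hv, h⟩ => ⟨hne.symm, v, hv, u, hu, h.symm⟩⟩
  loopless := ⟨fun _ h => h.1 rfl⟩

/-- The sets `B a` are the branch sets of an `X` minor in `Y`: they are connected (in particular
nonempty) and pairwise disjoint, and `Y` has an edge between `B a` and `B b` whenever `ab` is an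
edge of `X`. -/
structure IsMinorModel {α β : Type*} (X : SimpleGraph α) (Y : SimpleGraph β)
    (B : α → Set β) : Prop where
  connected : ∀ a, (Y.induce (B a)).Connected
  disjoint : ∀ a b, a ≠ b → Disjoint (B a) (B b)
  adj : ∀ a b, X.Adj a b → ∃ u ∈ B a, ∃ v ∈ B b, Y.Adj u v

/-- A subdivision of `X` in `Y`: distinct branch vertices for the vertices of `X`, and a path
for every edge of `X` between the branch vertices of its ends (one path per unordered edge, the two
orientations being reverses of each other), such that no branch vertex is an inner vertex of a path
and the paths of distinct edges have no inner vertices in common. -/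
structure SubdivisionIn {α β : Type*} (X : SimpleGraph α) (Y : SimpleGraph β) where
  branchVertex : α → β
  injective : Function.Injective branchVertex
  path : ∀ a b, X.Adj a b → Y.Walk (branchVertex a) (branchVertex b)
  isPath : ∀ a b (h : X.Adj a b), (path a b h).IsPath
  path_symm : ∀ a b (h : X.Adj a b), path b a h.symm = (path a b h).reverse
  branchVertex_mem : ∀ a b (h : X.Adj a b) c,
    branchVertex c ∈ (path a b h).support → c = a ∨ c = b
  independent : ∀ a b (h : X.Adj a b) c d (k : X.Adj c d), s(a, b) ≠ s(c, d) →
    ∀ w, w ∈ (path a b h).support → w ∈ (path c d k).support → w ∈ Set.range branchVertex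

/-- `X` is a topological minor of `Y`: `Y` contains a subdivision of `X`. -/
def IsTopologicalMinor {α β : Type*} (X : SimpleGraph α) (Y : SimpleGraph β) : Prop :=
  Nonempty (SubdivisionIn X Y)

/-!
**The minor.** Contracting the middle third edge `{a + Δ/3, a + 2Δ/3}` of a Cantor interval
`[a, a + Δ]` turns the path `a, a + 2Δ/3, a + Δ/3, a + Δ` into a new vertex joined to both ends of
the interval, and the two subintervals play the roles of the two new blue edges.  So `G*` becomes a
halved Farey graph without its edge of order `0`.  A word of length `n` names both a blue edge of
order `n` and a Cantor interval of level `n`; `branchLo` and `branchHi` give the two elements of the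
branch set of each vertex of the Farey graph.  They are told apart by writing them as reduced
fractions with powers of three as denominators (`branchPair_unique`), and the remaining edges
of `H` correspond to the blue edges (`linkEdge_ends`, `whirlFareySubgraph_adj`).

**No topological minor.** A vertex `x` of the Farey graph and its neighbours in one of the halves
form an infinite fan, and consecutive vertices of its rim are joined by a second, independent path
through the new vertex of their edge.  Suppose that the whirl graph contains a subdivision of this
fan, with centre `X` say.  Far enough down, the neighbours of `X` are the vertices
`X ± 2 / 3 ^ (k + 1)`; by symmetry infinitely many spokes use those on the positive side.
For `k` large, `p k = X + 1 / 3 ^ k` separates in `G - X` the vertices between `X` and `p k` from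
the others.  Only finitely many `p k` are inner vertices of spokes, since such a `p k`
forces the whole rim to lie between `X` and `p k`.  For the remaining `k` the vertex `p k` separates
the rim, and as consecutive rim vertices are joined by two independent paths, `p k` is a rim vertex.
The spoke that ends in `p k` must use one of the two neighbours of `X` on either side of `p k`, say
`q = X + 2 / 3 ^ (l + 1)`.  But in `G - X - q` the parts of the graph before and after `q`
are joined only by the edge between `p (l + 1)` and `p l`, while the rim together with its second
paths is 2-edge-connected: a contradiction (`FanSubdivision.false_of_triadicSeparated`).
-/

/-! ### Subdivided fans and triadic separations -/

/-- A subdivision in `G` of the fan whose centre is joined to the vertices of the ray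
`rim 0, rim 1, …`, together with an additional vertex `apex i` joined to `rim i` and `rim (i + 1)`
for each `i`.  The walk `spoke i` is the path from the centre to `rim i` without its first
vertex; `first i` is the vertex that follows the centre on that path. -/
structure FanSubdivision {V : Type*} (G : SimpleGraph V) where
  center : V
  first : ℕ → V
  rim : ℕ → V
  apex : ℕ → V
  spoke : ∀ i, G.Walk (first i) (rim i)
  base : ∀ i, G.Walk (rim i) (rim (i + 1))
  sideL : ∀ i, G.Walk (rim i) (apex i)
  sideR : ∀ i, G.Walk (apex i) (rim (i + 1))
  adj_first : ∀ i, G.Adj center (first i)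
  center_spoke : ∀ i, center ∉ (spoke i).support
  center_base : ∀ i, center ∉ (base i).support
  center_sideL : ∀ i, center ∉ (sideL i).support
  center_sideR : ∀ i, center ∉ (sideR i).support
  spoke_spoke : ∀ i j, i ≠ j → ∀ w, w ∈ (spoke i).support → w ∉ (spoke j).support
  spoke_base : ∀ i j w, w ∈ (spoke i).support → w ∈ (base j).support → w = rim i
  spoke_sideL : ∀ i j w, w ∈ (spoke i).support → w ∈ (sideL j).support → w = rim i
  spoke_sideR : ∀ i j w, w ∈ (spoke i).support → w ∈ (sideR j).support → w = rim i
  base_sideL : ∀ i w, w ∈ (base i).support → w ∈ (sideL i).support → w = rim i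
  base_sideR : ∀ i w, w ∈ (base i).support → w ∈ (sideR i).support → w = rim (i + 1)

/-- With respect to the coordinate `d`, the two endpoints of every triadic interval of length at
most `1 / 3 ^ n` to the right of the origin separate its interior from all other vertices. -/
def TriadicSeparated {V : Type*} (G : SimpleGraph V) (d : V → ℚ) (n : ℕ) : Prop :=
  ∀ k, n ≤ k → ∀ c : ℕ, ∀ u w, G.Adj u w → (c : ℚ) / 3 ^ k < d u → d u < (c + 1 : ℚ) / 3 ^ k →
    (c : ℚ) / 3 ^ k ≤ d w ∧ d w ≤ (c + 1 : ℚ) / 3 ^ k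

theorem SimpleGraph.Walk.exists_crossing {V : Type*} {G : SimpleGraph V} {u v : V}
    (p : G.Walk u v) (A : Set V) (h : ¬ (u ∈ A ↔ v ∈ A)) :
    ∃ a ∈ A, ∃ b ∉ A, G.Adj a b ∧ a ∈ p.support ∧ b ∈ p.support := by
  by_cases hu : u ∈ A
  · obtain ⟨e, he, h1, h2⟩ := p.exists_boundary_dart A hu (by tauto)
    exact ⟨_, h1, _, h2, e.adj, p.dart_fst_mem_support_of_mem_darts he,
      p.dart_snd_mem_support_of_mem_darts he⟩
  · obtain ⟨e, he, h1, h2⟩ := p.reverse.exists_boundary_dart A (by tauto) hu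
    have h3 := p.reverse.dart_fst_mem_support_of_mem_darts he
    have h4 := p.reverse.dart_snd_mem_support_of_mem_darts he
    rw [SimpleGraph.Walk.support_reverse, List.mem_reverse] at h3 h4
    exact ⟨_, h1, _, h2, e.adj, h3, h4⟩

theorem Nat.exists_not_iff_succ {P : ℕ → Prop} {a b : ℕ} (ha : P a) (hb : ¬ P b) :
    ∃ j, ¬ (P j ↔ P (j + 1)) := by
  by_contra! h
  have h0 : ∀ j, P j ↔ P 0 := fun j => by
    induction j with
    | zero => rfl
    | succ j ih => rw [← ih, h j]
  exact hb ((h0 b).2 ((h0 a).1 ha))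

section Crossing

variable {V : Type*} {G : SimpleGraph V} {d : V → ℚ} {n k : ℕ} {x u v : V}

/-- Away from the origin, the interval `(0, 1 / 3 ^ k)` can only be left through the vertex
`1 / 3 ^ k`. -/
theorem TriadicSeparated.exists_mem_support (hs : TriadicSeparated G d n)
    (hd : Function.Injective d) (hx : d x = 0) (hk : n ≤ k) (p : G.Walk u v)
    (hp : x ∉ p.support) (h : ¬ ((0 < d u ∧ d u < 1 / 3 ^ k) ↔ (0 < d v ∧ d v < 1 / 3 ^ k))) :
    ∃ w ∈ p.support, d w = 1 / 3 ^ k := by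
  obtain ⟨a, ha, b, hb, hab, -, hbp⟩ :=
    p.exists_crossing {w | 0 < d w ∧ d w < 1 / 3 ^ k} (by simpa using h)
  have h1 := hs k hk 0 a b hab (by simpa using ha.1) (by simpa using ha.2)
  simp only [Nat.cast_zero, zero_div, zero_add] at h1
  refine ⟨b, hbp, le_antisymm h1.2 (not_lt.1 fun h2 => ?_)⟩
  rcases h1.1.eq_or_lt with h3 | h3
  · exact hp (hd (hx.trans h3) ▸ hbp)
  · exact hb ⟨h3, h2⟩

/-- Away from the origin and the vertex `2 / 3 ^ (k + 1)`, the only edge that leaves the interval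
`(0, 2 / 3 ^ (k + 1))` is the edge between `1 / 3 ^ (k + 1)` and `1 / 3 ^ k`. -/
theorem TriadicSeparated.exists_mem_support_pair (hs : TriadicSeparated G d n)
    (hd : Function.Injective d) (hx : d x = 0) (hk : n ≤ k) (p : G.Walk u v)
    (hp : x ∉ p.support) (hq : ∀ w ∈ p.support, d w ≠ 2 / 3 ^ (k + 1))
    (h : ¬ ((0 < d u ∧ d u < 2 / 3 ^ (k + 1)) ↔ (0 < d v ∧ d v < 2 / 3 ^ (k + 1)))) :
    (∃ w ∈ p.support, d w = 1 / 3 ^ k) ∧ ∃ w ∈ p.support, d w = 1 / 3 ^ (k + 1) := by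
  obtain ⟨a, ha, b, hb, hab, hap, hbp⟩ :=
    p.exists_crossing {w | 0 < d w ∧ d w < 2 / 3 ^ (k + 1)} (by simpa using h)
  obtain ⟨ha1, ha2⟩ := ha
  have hpos : (0 : ℚ) < 1 / 3 ^ (k + 1) := by positivity
  have e2 : (2 : ℚ) / 3 ^ (k + 1) = 2 * (1 / 3 ^ (k + 1)) := by ring
  have e3 : (1 : ℚ) / 3 ^ k = 3 * (1 / 3 ^ (k + 1)) := by rw [pow_succ]; field_simp
  have h0 := hs k hk 0 a b hab (by simpa using ha1)
    (by simp only [Nat.cast_zero, zero_add]; linarith)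
  have hb0 : d b ≠ 0 := fun h => hp (hd (hx.trans h.symm) ▸ hbp)
  simp only [Nat.cast_zero, zero_div, zero_add] at h0
  have hb1 : 0 < d b := lt_of_le_of_ne h0.1 hb0.symm
  have hb2 : 2 / 3 ^ (k + 1) < d b :=
    lt_of_le_of_ne (not_lt.1 fun h => hb ⟨hb1, h⟩) (hq b hbp).symm
  have ha3 : d a = 1 / 3 ^ (k + 1) := by
    rcases lt_trichotomy (d a) (1 / 3 ^ (k + 1)) with h1 | h1 | h1
    · have := (hs (k + 1) (by omega) 0 a b hab (by simpa using ha1) (by simpa using h1)).2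
      simp only [Nat.cast_zero, zero_add] at this
      linarith
    · exact h1
    · have := (hs (k + 1) (by omega) 1 a b hab (by simpa using h1)
        (by norm_num at ha2 ⊢; exact ha2)).2
      norm_num at this
      linarith
  refine ⟨⟨b, hbp, le_antisymm h0.2 (not_lt.1 fun h1 => ?_)⟩, a, hap, ha3⟩
  have := (hs (k + 1) (by omega) 2 b a hab.symm (by simpa using hb2)
    (by rw [e3] at h1; norm_num at h1 ⊢; rw [div_eq_mul_inv]; exact h1)).1
  simp only [Nat.cast_ofNat] at this
  linarith

end Crossing

namespace FanSubdivision

variable {V : Type*} {G : SimpleGraph V} {d : V → ℚ} {n : ℕ}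

/-- If a spoke passes through the vertex `1 / 3 ^ k`, then the rim does not, so it stays on one
side of it; as infinitely many spokes start in `(0, 1 / 3 ^ k)`, this is the side of the origin. -/
theorem rim_mem_of_spoke (F : FanSubdivision G) (hs : TriadicSeparated G d n)
    (hd : Function.Injective d) (hx : d F.center = 0)
    (hinf : ∀ N, ∃ i m, N < m ∧ d (F.first i) = 2 / 3 ^ m) {k : ℕ} (hk : n ≤ k) {i : ℕ} {w : V}
    (hw : w ∈ (F.spoke i).support) (hwi : w ≠ F.rim i) (hwk : d w = 1 / 3 ^ k) (j : ℕ) :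
    0 < d (F.rim j) ∧ d (F.rim j) < 1 / 3 ^ k := by
  -- Otherwise no rim vertex lies in `(0, 1 / 3 ^ k)`, and two spokes that start there share `w`.
  by_contra hj
  have hnone : ∀ l, ¬ (0 < d (F.rim l) ∧ d (F.rim l) < 1 / 3 ^ k) := by
    intro l hl
    obtain ⟨t, ht⟩ := Nat.exists_not_iff_succ
      (P := fun l => 0 < d (F.rim l) ∧ d (F.rim l) < 1 / 3 ^ k) hl hj
    obtain ⟨w', hw', hwk'⟩ := hs.exists_mem_support hd hx hk (F.base t) (F.center_base t) ht
    obtain rfl := hd (hwk.trans hwk'.symm)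
    exact hwi (F.spoke_base _ _ _ hw hw')
  have hlt : ∀ {m : ℕ}, k < m → (0 : ℚ) < 2 / 3 ^ m ∧ (2 : ℚ) / 3 ^ m < 1 / 3 ^ k := by
    intro m hm
    refine ⟨by positivity, ?_⟩
    have : (3 : ℚ) ^ (k + 1) ≤ 3 ^ m := pow_le_pow_right₀ (by norm_num) hm
    rw [pow_succ] at this
    have h3 : (0 : ℚ) < 3 ^ k := by positivity
    rw [div_lt_div_iff₀ (by positivity) h3]
    linarith
  have hcross : ∀ {l m : ℕ}, k < m → d (F.first l) = 2 / 3 ^ m → w ∈ (F.spoke l).support := by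
    intro l m hm hl
    obtain ⟨w', hw', hwk'⟩ := hs.exists_mem_support hd hx hk (F.spoke l) (F.center_spoke l)
      (fun h => hnone l (h.1 (by rw [hl]; exact hlt hm)))
    rwa [hd (hwk.trans hwk'.symm)]
  obtain ⟨l, m, hm, hl⟩ := hinf k
  obtain ⟨l', m', hm', hl'⟩ := hinf m
  refine F.spoke_spoke l l' ?_ w (hcross hm hl) (hcross (hm.trans hm') hl')
  rintro rfl
  rw [hl] at hl'
  have : (3 : ℚ) ^ m < 3 ^ m' := pow_lt_pow_right₀ (by norm_num) hm'
  have h3 : (2 : ℚ) / 3 ^ m' < 2 / 3 ^ m := by gcongr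
  exact h3.ne' hl'

/-- All vertices `1 / 3 ^ k` that are close enough to the origin avoid the interiors of the
spokes. -/
theorem exists_spoke_avoids (F : FanSubdivision G) (hs : TriadicSeparated G d n)
    (hd : Function.Injective d) (hx : d F.center = 0)
    (hinf : ∀ N, ∃ i m, N < m ∧ d (F.first i) = 2 / 3 ^ m) :
    ∃ N, n ≤ N ∧ (∀ k, N ≤ k → ¬ (0 < d (F.rim 0) ∧ d (F.rim 0) < 1 / 3 ^ k)) ∧
      ∀ k, N ≤ k → ∀ i, ∀ w ∈ (F.spoke i).support, d w = 1 / 3 ^ k → w = F.rim i := by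
  obtain ⟨N, hN⟩ : ∃ N, ∀ k, N ≤ k → ¬ (0 < d (F.rim 0) ∧ d (F.rim 0) < 1 / 3 ^ k) := by
    by_cases h0 : 0 < d (F.rim 0)
    · obtain ⟨N, hN⟩ := exists_pow_lt_of_lt_one h0 (by norm_num : (1 / 3 : ℚ) < 1)
      refine ⟨N, fun k hk h => ?_⟩
      have : (1 / 3 : ℚ) ^ k ≤ (1 / 3) ^ N := pow_le_pow_of_le_one (by norm_num) (by norm_num) hk
      rw [one_div_pow] at this
      linarith [h.2]
    · exact ⟨0, fun k _ h => h0 h.1⟩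
  refine ⟨max n N, le_max_left _ _, fun k hk => hN k (le_trans (le_max_right _ _) hk), ?_⟩
  intro k hk i w hw hwk
  by_contra hwi
  exact hN k (le_trans (le_max_right _ _) hk)
    (F.rim_mem_of_spoke hs hd hx hinf (le_trans (le_max_left _ _) hk) hw hwi hwk 0)

/-- Every vertex `1 / 3 ^ k` close enough to the origin separates the rim.  Since consecutive rim
vertices are joined by two independent paths, such a vertex is itself a rim vertex. -/
theorem exists_rim_eq (F : FanSubdivision G) (hs : TriadicSeparated G d n)
    (hd : Function.Injective d) (hx : d F.center = 0)
    (hinf : ∀ N, ∃ i m, N < m ∧ d (F.first i) = 2 / 3 ^ m) {N : ℕ} (hnN : n ≤ N)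
    (h0 : ∀ k, N ≤ k → ¬ (0 < d (F.rim 0) ∧ d (F.rim 0) < 1 / 3 ^ k))
    (hN : ∀ k, N ≤ k → ∀ i, ∀ w ∈ (F.spoke i).support, d w = 1 / 3 ^ k → w = F.rim i)
    {k : ℕ} (hk : N ≤ k) : ∃ j, d (F.rim j) = 1 / 3 ^ k := by
  have e3 : (1 : ℚ) / 3 ^ k = 3 * (1 / 3 ^ (k + 1)) := by rw [pow_succ]; field_simp
  have hpos : (0 : ℚ) < 1 / 3 ^ (k + 1) := by positivity
  obtain ⟨i, hi⟩ : ∃ i, 0 < d (F.rim i) ∧ d (F.rim i) < 1 / 3 ^ k := by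
    obtain ⟨i, m, hm, hi⟩ := hinf (k + 1)
    refine ⟨i, ?_⟩
    by_cases hr : 0 < d (F.rim i) ∧ d (F.rim i) < 1 / 3 ^ (k + 1)
    · exact ⟨hr.1, by linarith [hr.2]⟩
    · obtain ⟨w, hw, hwk⟩ := hs.exists_mem_support hd hx (by omega : n ≤ k + 1) (F.spoke i)
        (F.center_spoke i) (fun h => hr (h.1 (by
          rw [hi]
          refine ⟨by positivity, ?_⟩
          have : (3 : ℚ) ^ (k + 1 + 1) ≤ 3 ^ m := pow_le_pow_right₀ (by norm_num) hm
          rw [pow_succ] at this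
          have h3 : (0 : ℚ) < 3 ^ (k + 1) := by positivity
          rw [div_lt_div_iff₀ (by positivity) h3]
          linarith)))
      obtain rfl := hN (k + 1) (by omega) i w hw hwk
      rw [hwk]
      exact ⟨hpos, by linarith⟩
  obtain ⟨t, ht⟩ := Nat.exists_not_iff_succ
    (P := fun l => 0 < d (F.rim l) ∧ d (F.rim l) < 1 / 3 ^ k) hi (h0 k hk)
  have hnk : n ≤ k := by omega
  obtain ⟨w, hw, hwk⟩ := hs.exists_mem_support hd hx hnk (F.base t) (F.center_base t) ht
  by_cases hL : ((0 < d (F.rim t) ∧ d (F.rim t) < 1 / 3 ^ k) ↔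
      (0 < d (F.apex t) ∧ d (F.apex t) < 1 / 3 ^ k))
  · obtain ⟨w', hw', hwk'⟩ := hs.exists_mem_support hd hx hnk (F.sideR t) (F.center_sideR t)
      (fun h => ht (hL.trans h))
    obtain rfl := hd (hwk.trans hwk'.symm)
    exact ⟨t + 1, F.base_sideR t _ hw hw' ▸ hwk⟩
  · obtain ⟨w', hw', hwk'⟩ := hs.exists_mem_support hd hx hnk (F.sideL t) (F.center_sideL t) hL
    obtain rfl := hd (hwk.trans hwk'.symm)
    exact ⟨t, F.base_sideL t _ hw hw' ▸ hwk⟩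

/-- A spoke that ends in a vertex `1 / 3 ^ (k + 1)` close to the origin cannot pass through any
other vertex of this form, so it stays between `1 / 3 ^ (k + 2)` and `1 / 3 ^ k` and starts in a
neighbour `2 / 3 ^ (l + 1)` of the centre there. -/
theorem exists_first_eq (F : FanSubdivision G) (hs : TriadicSeparated G d n)
    (hd : Function.Injective d) (hx : d F.center = 0)
    (hadj : ∀ w, G.Adj F.center w → 0 < d w → d w < 1 / 3 ^ n → ∃ m, d w = 2 / 3 ^ m)
    {N : ℕ} (hnN : n ≤ N)
    (hN : ∀ k, N ≤ k → ∀ i, ∀ w ∈ (F.spoke i).support, d w = 1 / 3 ^ k → w = F.rim i)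
    {k j : ℕ} (hk : N ≤ k) (hj : d (F.rim j) = 1 / 3 ^ (k + 1)) :
    ∃ l, N ≤ l ∧ d (F.first j) = 2 / 3 ^ (l + 1) := by
  have e2 : (1 : ℚ) / 3 ^ (k + 1) = 3 * (1 / 3 ^ (k + 2)) := by rw [pow_succ _ (k + 1)]; field_simp
  have e3 : (1 : ℚ) / 3 ^ k = 3 * (1 / 3 ^ (k + 1)) := by rw [pow_succ]; field_simp
  have hpos : (0 : ℚ) < 1 / 3 ^ (k + 2) := by positivity
  have hmem : 1 / 3 ^ (k + 2) < d (F.first j) ∧ d (F.first j) < 1 / 3 ^ k := by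
    by_contra hf
    obtain ⟨a, ha, b, hb, hab, -, hbp⟩ := (F.spoke j).exists_crossing
      {w | 1 / 3 ^ (k + 2) < d w ∧ d w < 1 / 3 ^ k}
      (fun h => hf (h.2 ⟨by rw [hj]; linarith, by rw [hj]; linarith⟩))
    obtain ⟨ha1, ha2⟩ := ha
    have h1 := hs k (by omega) 0 a b hab (by simpa using hpos.trans ha1) (by simpa using ha2)
    simp only [Nat.cast_zero, zero_div, zero_add] at h1
    have hb0 : 0 < d b := lt_of_le_of_ne h1.1
      fun h => F.center_spoke j (hd (hx.trans h) ▸ hbp)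
    rcases h1.2.eq_or_lt with h2 | h2
    · have := hN k hk j b hbp h2
      rw [this, hj] at h2
      linarith
    have h3 : d b ≤ 1 / 3 ^ (k + 2) := not_lt.1 fun h => hb ⟨h, h2⟩
    rcases h3.eq_or_lt with h4 | h4
    · have := hN (k + 2) (by omega) j b hbp h4
      rw [this, hj] at h4
      linarith
    · have := (hs (k + 2) (by omega) 0 b a hab.symm (by simpa using hb0) (by simpa using h4)).2
      simp only [Nat.cast_zero, zero_add] at this
      linarith
  obtain ⟨m, hm⟩ := hadj _ (F.adj_first j) (hpos.trans hmem.1) (hmem.2.trans_le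
    (one_div_le_one_div_of_le (by positivity) (pow_le_pow_right₀ (by norm_num) (by omega))))
  rw [hm] at hmem
  have hkm : k < m := by
    by_contra h
    have h1 : (3 : ℚ) ^ m ≤ 3 ^ k := pow_le_pow_right₀ (by norm_num) (by omega)
    have := hmem.2
    rw [div_lt_div_iff₀ (by positivity) (by positivity)] at this
    have h3 : (0 : ℚ) < 3 ^ k := by positivity
    linarith
  exact ⟨m - 1, by omega, by rw [hm]; congr 2; omega⟩

/-- A graph with triadic separations contains no subdivided fan whose spokes accumulate at the
origin.  All vertices `1 / 3 ^ k` close to the origin are rim vertices, and between some two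
consecutive ones the vertex `2 / 3 ^ (k + 1)` is used up by a spoke, which leaves a single edge to
connect the two parts of the rim. -/
theorem false_of_triadicSeparated (F : FanSubdivision G) (hs : TriadicSeparated G d n)
    (hd : Function.Injective d) (hx : d F.center = 0)
    (hadj : ∀ w, G.Adj F.center w → 0 < d w → d w < 1 / 3 ^ n → ∃ m, d w = 2 / 3 ^ m)
    (hinf : ∀ N, ∃ i m, N < m ∧ d (F.first i) = 2 / 3 ^ m) : False := by
  obtain ⟨N, hnN, h0, hN⟩ := F.exists_spoke_avoids hs hd hx hinf
  have hrim : ∀ k, N ≤ k → ∃ j, d (F.rim j) = 1 / 3 ^ k :=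
    fun k hk => F.exists_rim_eq hs hd hx hinf hnN h0 hN hk
  obtain ⟨j, hj⟩ := hrim (N + 1) (by omega)
  obtain ⟨l, hl, hq⟩ := F.exists_first_eq hs hd hx hadj hnN hN le_rfl hj
  have e3 : (1 : ℚ) / 3 ^ l = 3 * (1 / 3 ^ (l + 1)) := by rw [pow_succ]; field_simp
  have e2 : (2 : ℚ) / 3 ^ (l + 1) = 2 * (1 / 3 ^ (l + 1)) := by ring
  have hpos : (0 : ℚ) < 1 / 3 ^ (l + 1) := by positivity
  have hfr : F.first j ≠ F.rim j := by
    intro h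
    rw [h, hj] at hq
    -- `1 / 3 ^ (N + 1) = 2 / 3 ^ (l + 1)` fails by parity
    rw [div_eq_div_iff (by positivity) (by positivity), one_mul] at hq
    have h2 : (3 ^ (l + 1) : ℕ) = 2 * 3 ^ (N + 1) := by exact_mod_cast hq
    have h3 : Odd (3 ^ (l + 1) : ℕ) := Odd.pow (by decide)
    rw [h2] at h3
    exact (Nat.not_odd_iff_even.2 (even_two_mul _)) h3
  have hne : ∀ {w}, d w = 2 / 3 ^ (l + 1) → w = F.first j := fun h => hd (h.trans hq.symm)
  have hfs : F.first j ∈ (F.spoke j).support := (F.spoke j).start_mem_support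
  obtain ⟨a, ha⟩ := hrim l hl
  obtain ⟨b, hb⟩ := hrim (l + 1) (by omega)
  -- Consecutive rim vertices on different sides of the used vertex `F.first j`: both paths between
  -- them contain both ends of the only edge that crosses.
  obtain ⟨t, ht⟩ := Nat.exists_not_iff_succ
    (P := fun i => 0 < d (F.rim i) ∧ d (F.rim i) < 2 / 3 ^ (l + 1)) (a := b) (b := a)
    ⟨by rw [hb]; exact hpos, by rw [hb]; linarith⟩ (fun h => by rw [ha] at h; linarith [h.2])
  have hnl : n ≤ l := by omega
  obtain ⟨⟨w₁, hw₁, hd₁⟩, w₂, hw₂, hd₂⟩ := hs.exists_mem_support_pair hd hx hnl (F.base t)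
    (F.center_base t) (fun w hw h => hfr (F.spoke_base j t _ hfs (hne h ▸ hw))) ht
  have hw : w₁ ≠ w₂ := fun h => by rw [h, hd₂] at hd₁; linarith
  by_cases hL : ((0 < d (F.rim t) ∧ d (F.rim t) < 2 / 3 ^ (l + 1)) ↔
      (0 < d (F.apex t) ∧ d (F.apex t) < 2 / 3 ^ (l + 1)))
  · obtain ⟨⟨w₁', hw₁', hd₁'⟩, w₂', hw₂', hd₂'⟩ := hs.exists_mem_support_pair hd hx hnl
      (F.sideR t) (F.center_sideR t)
      (fun w hw h => hfr (F.spoke_sideR j t _ hfs (hne h ▸ hw))) (fun h => ht (hL.trans h))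
    obtain rfl := hd (hd₁.trans hd₁'.symm)
    obtain rfl := hd (hd₂.trans hd₂'.symm)
    exact hw ((F.base_sideR t _ hw₁ hw₁').trans (F.base_sideR t _ hw₂ hw₂').symm)
  · obtain ⟨⟨w₁', hw₁', hd₁'⟩, w₂', hw₂', hd₂'⟩ := hs.exists_mem_support_pair hd hx hnl
      (F.sideL t) (F.center_sideL t)
      (fun w hw h => hfr (F.spoke_sideL j t _ hfs (hne h ▸ hw))) hL
    obtain rfl := hd (hd₁.trans hd₁'.symm)
    obtain rfl := hd (hd₂.trans hd₂'.symm)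
    exact hw ((F.base_sideL t _ hw₁ hw₁').trans (F.base_sideL t _ hw₂ hw₂').symm)

end FanSubdivision

/-! ### Edges of the Farey graph -/

theorem length_lt_of_blueEnds {e w : List Bool}
    (h : (blueEnds e).1 = .new w ∨ (blueEnds e).2 = .new w) : w.length < e.length := by
  induction e with
  | nil => simp [blueEnds] at h
  | cons b e ih =>
    cases b <;> simp only [blueEnds, HalvedFareyVertex.new.injEq] at h <;>
      rcases h with h | h
    · exact (ih (.inl h)).trans (by simp)
    · simp [h]
    · simp [h]
    · exact (ih (.inr h)).trans (by simp)

theorem blueEnds_ne (e : List Bool) : (blueEnds e).1 ≠ (blueEnds e).2 := by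
  rcases e with _ | ⟨_ | _, e⟩
  · simp [blueEnds]
  · exact fun h => lt_irrefl _ (length_lt_of_blueEnds (e := e) (w := e) (.inl h))
  · exact fun h => lt_irrefl _ (length_lt_of_blueEnds (e := e) (w := e) (.inr h.symm))

theorem fareyCopy_injective (i : Bool) : Function.Injective (fareyCopy i) := by
  intro u v h
  cases u <;> cases v <;> simp_all [fareyCopy]

theorem fareyGraph_adj {u v : FareyVertex} : fareyGraph.Adj u v ↔
    ∃ i w, s(u, v) = s(fareyCopy i (blueEnds w).1, fareyCopy i (blueEnds w).2) := by
  have key : ∀ i, (halvedFareyGraph.map (fareyCopy i)).Adj u v ↔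
      ∃ w, s(u, v) = s(fareyCopy i (blueEnds w).1, fareyCopy i (blueEnds w).2) := by
    intro i
    rw [SimpleGraph.map_adj']
    simp only [halvedFareyGraph, SimpleGraph.fromEdgeSet_adj, Set.mem_iUnion, blueEdges,
      Set.mem_ofPred_eq]
    constructor
    · rintro ⟨-, a, b, ⟨⟨n, e, -, h⟩, -⟩, rfl, rfl⟩
      exact ⟨e, by simpa using congrArg (Sym2.map (fareyCopy i)) h⟩
    · rintro ⟨w, h⟩
      have hne := blueEnds_ne w
      have hne' := (fareyCopy_injective i).ne hne
      rcases Sym2.eq_iff.1 h with ⟨rfl, rfl⟩ | ⟨rfl, rfl⟩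
      · exact ⟨hne', _, _, ⟨⟨_, w, rfl, rfl⟩, hne⟩, rfl, rfl⟩
      · exact ⟨hne'.symm, _, _, ⟨⟨_, w, rfl, Sym2.eq_swap⟩, hne.symm⟩, rfl, rfl⟩
  rw [fareyGraph, SimpleGraph.sup_adj, key, key, Bool.exists_bool]

/-! ### Subdivisions of the Farey graph contain subdivided fans -/

/-- The neighbours `y`, `v_e`, … of the vertex `x` in one of the halves of the Farey graph,
numbered along the path that they induce. -/
def fareyRim : ℕ → FareyVertex
  | 0 => .y
  | i + 1 => .new false (List.replicate i false)

/-- The new vertex for the blue edge between `fareyRim i` and `fareyRim (i + 1)`. -/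
def fareyApex (i : ℕ) : FareyVertex := .new false (true :: List.replicate i false)

theorem fareyCopy_blueEnds_replicate (i : ℕ) :
    fareyCopy false (blueEnds (List.replicate i false)).1 = .x ∧
      fareyCopy false (blueEnds (List.replicate i false)).2 = fareyRim i := by
  induction i with
  | zero => exact ⟨rfl, rfl⟩
  | succ i ih => exact ⟨ih.1, rfl⟩

theorem fareyGraph_adj_rim (i : ℕ) : fareyGraph.Adj .x (fareyRim i) :=
  fareyGraph_adj.2 ⟨false, List.replicate i false, by
    rw [(fareyCopy_blueEnds_replicate i).1, (fareyCopy_blueEnds_replicate i).2]⟩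

theorem fareyGraph_rim_adj_succ (i : ℕ) : fareyGraph.Adj (fareyRim i) (fareyRim (i + 1)) :=
  fareyGraph_adj.2 ⟨false, true :: List.replicate i false, by
    rw [← (fareyCopy_blueEnds_replicate i).2]; exact Sym2.eq_swap⟩

theorem fareyGraph_rim_adj_apex (i : ℕ) : fareyGraph.Adj (fareyRim i) (fareyApex i) :=
  fareyGraph_adj.2 ⟨false, true :: true :: List.replicate i false, by
    rw [← (fareyCopy_blueEnds_replicate i).2]; exact Sym2.eq_swap⟩

theorem fareyGraph_apex_adj_rim (i : ℕ) : fareyGraph.Adj (fareyApex i) (fareyRim (i + 1)) :=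
  fareyGraph_adj.2 ⟨false, false :: true :: List.replicate i false, Sym2.eq_swap⟩

theorem fareyRim_injective : Function.Injective fareyRim := by
  intro i j h
  rcases i with _ | i <;> rcases j with _ | j
  · rfl
  · simp [fareyRim] at h
  · simp [fareyRim] at h
  · simp only [fareyRim, FareyVertex.new.injEq, true_and] at h
    simpa using congrArg List.length h

theorem x_ne_fareyRim (i : ℕ) : FareyVertex.x ≠ fareyRim i := (fareyGraph_adj_rim i).ne

theorem x_ne_fareyApex (i : ℕ) : FareyVertex.x ≠ fareyApex i := by simp [fareyApex]

theorem fareyRim_ne_fareyApex (i j : ℕ) : fareyRim i ≠ fareyApex j := by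
  rcases i with _ | _ | i
  · simp [fareyRim, fareyApex]
  · simp [fareyRim, fareyApex]
  · simp [fareyRim, fareyApex, List.replicate_succ]

/-- The paths of two distinct edges meet at most in the branch vertices of common ends. -/
theorem SubdivisionIn.exists_common_end {α β : Type*} {X : SimpleGraph α} {Y : SimpleGraph β}
    (S : SubdivisionIn X Y) {a b c e : α} (h : X.Adj a b) (k : X.Adj c e)
    (hne : s(a, b) ≠ s(c, e)) {w : β} (hw : w ∈ (S.path a b h).support)
    (hw' : w ∈ (S.path c e k).support) :
    ∃ v, S.branchVertex v = w ∧ (v = a ∨ v = b) ∧ (v = c ∨ v = e) := by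
  obtain ⟨v, rfl⟩ := S.independent a b h c e k hne w hw hw'
  exact ⟨v, rfl, S.branchVertex_mem a b h v hw, S.branchVertex_mem c e k v hw'⟩

theorem SubdivisionIn.path_not_nil {α β : Type*} {X : SimpleGraph α} {Y : SimpleGraph β}
    (S : SubdivisionIn X Y) {a b : α} (h : X.Adj a b) : ¬ (S.path a b h).Nil :=
  SimpleGraph.Walk.not_nil_of_ne (S.injective.ne h.ne)

theorem SubdivisionIn.mem_of_mem_tail {α β : Type*} {X : SimpleGraph α} {Y : SimpleGraph β}
    (S : SubdivisionIn X Y) {a b : α} (h : X.Adj a b) {w : β}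
    (hw : w ∈ (S.path a b h).tail.support) : w ∈ (S.path a b h).support := by
  rw [SimpleGraph.Walk.support_tail_of_not_nil _ (S.path_not_nil h)] at hw
  exact List.mem_of_mem_tail hw

theorem SubdivisionIn.notMem_tail {α β : Type*} {X : SimpleGraph α} {Y : SimpleGraph β}
    (S : SubdivisionIn X Y) {a b : α} (h : X.Adj a b) :
    S.branchVertex a ∉ (S.path a b h).tail.support := by
  rw [SimpleGraph.Walk.support_tail_of_not_nil _ (S.path_not_nil h)]
  have := (S.isPath a b h).support_nodup
  rw [← SimpleGraph.Walk.cons_tail_support] at this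
  exact (List.nodup_cons.1 this).1

/-- A subdivision of the Farey graph contains a subdivided fan with centre `x`. -/
def SubdivisionIn.fan {β : Type*} {Y : SimpleGraph β} (S : SubdivisionIn fareyGraph Y) :
    FanSubdivision Y where
  center := S.branchVertex .x
  first i := (S.path _ _ (fareyGraph_adj_rim i)).snd
  rim i := S.branchVertex (fareyRim i)
  apex i := S.branchVertex (fareyApex i)
  spoke i := (S.path _ _ (fareyGraph_adj_rim i)).tail
  base i := S.path _ _ (fareyGraph_rim_adj_succ i)
  sideL i := S.path _ _ (fareyGraph_rim_adj_apex i)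
  sideR i := S.path _ _ (fareyGraph_apex_adj_rim i)
  adj_first i := SimpleGraph.Walk.adj_snd (S.path_not_nil _)
  center_spoke i := S.notMem_tail _
  center_base i h := (S.branchVertex_mem _ _ _ _ h).elim (x_ne_fareyRim _) (x_ne_fareyRim _)
  center_sideL i h := (S.branchVertex_mem _ _ _ _ h).elim (x_ne_fareyRim _) (x_ne_fareyApex _)
  center_sideR i h := (S.branchVertex_mem _ _ _ _ h).elim (x_ne_fareyApex _) (x_ne_fareyRim _)
  spoke_spoke i j hij w hw hw' := by
    have hr := fareyRim_injective.ne hij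
    obtain ⟨v, rfl, h1, h2⟩ := S.exists_common_end (fareyGraph_adj_rim i) (fareyGraph_adj_rim j)
      (by simp [hr, x_ne_fareyRim]) (S.mem_of_mem_tail _ hw) (S.mem_of_mem_tail _ hw')
    have hv : v ≠ .x := by rintro rfl; exact S.notMem_tail _ hw
    exact hr ((h1.resolve_left hv).symm.trans (h2.resolve_left hv))
  spoke_base i j w hw hw' := by
    obtain ⟨v, rfl, h1, h2⟩ := S.exists_common_end (fareyGraph_adj_rim i)
      (fareyGraph_rim_adj_succ j) (by simp [x_ne_fareyRim])
      (S.mem_of_mem_tail _ hw) hw'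
    have hv : v ≠ .x := by rintro rfl; exact S.notMem_tail _ hw
    rw [h1.resolve_left hv]
  spoke_sideL i j w hw hw' := by
    obtain ⟨v, rfl, h1, h2⟩ := S.exists_common_end (fareyGraph_adj_rim i)
      (fareyGraph_rim_adj_apex j) (by simp [x_ne_fareyRim, x_ne_fareyApex])
      (S.mem_of_mem_tail _ hw) hw'
    have hv : v ≠ .x := by rintro rfl; exact S.notMem_tail _ hw
    rw [h1.resolve_left hv]
  spoke_sideR i j w hw hw' := by
    obtain ⟨v, rfl, h1, h2⟩ := S.exists_common_end (fareyGraph_adj_rim i)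
      (fareyGraph_apex_adj_rim j) (by simp [x_ne_fareyRim, x_ne_fareyApex])
      (S.mem_of_mem_tail _ hw) hw'
    have hv : v ≠ .x := by rintro rfl; exact S.notMem_tail _ hw
    rw [h1.resolve_left hv]
  base_sideL i w hw hw' := by
    obtain ⟨v, rfl, h1, h2⟩ := S.exists_common_end (fareyGraph_rim_adj_succ i)
      (fareyGraph_rim_adj_apex i) (by simp [fareyRim_ne_fareyApex]) hw hw'
    have hv : v ≠ fareyApex i := by
      rintro rfl
      exact h1.elim (fareyRim_ne_fareyApex _ _).symm (fareyRim_ne_fareyApex _ _).symm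
    rw [h2.resolve_right hv]
  base_sideR i w hw hw' := by
    obtain ⟨v, rfl, h1, h2⟩ := S.exists_common_end (fareyGraph_rim_adj_succ i)
      (fareyGraph_apex_adj_rim i) (by simp [fareyRim_ne_fareyApex]) hw hw'
    have hv : v ≠ fareyApex i := by
      rintro rfl
      exact h1.elim (fareyRim_ne_fareyApex _ _).symm (fareyRim_ne_fareyApex _ _).symm
    rw [h2.resolve_left hv]

/-! ### Separations and neighbourhoods in the whirl graph -/

/-- The edges of the whirl graph in both orientations, with their ends as fractions whose
numerators are counted from the left end `3 * k` of the triadic interval that contains them. -/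
theorem whirlGraph_adj {u w : ℚ} (h : whirlGraph.Adj u w) :
    ∃ m k a b : ℕ, u = a / 3 ^ (m + 1) ∧ w = b / 3 ^ (m + 1) ∧ b ≤ 3 ^ (m + 1) ∧
      (a = 3 * k ∧ b = 3 * k + 2 ∨ a = 3 * k + 1 ∧ (b = 3 * k + 2 ∨ b = 3 * k + 3) ∨
        a = 3 * k + 2 ∧ (b = 3 * k ∨ b = 3 * k + 1) ∨ a = 3 * k + 3 ∧ b = 3 * k + 1) := by
  obtain ⟨-, -, -, n, hn, k, hk, h⟩ := h
  obtain ⟨m, rfl⟩ := Nat.exists_eq_succ_of_ne_zero (by omega : n ≠ 0)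
  simp only [Nat.succ_eq_add_one, Nat.add_sub_cancel] at h hk
  have hp : 3 ^ (m + 1) = 3 * 3 ^ m := pow_succ' _ _
  refine ⟨m, k, ?_⟩
  rcases h with h | h | h <;> rcases Sym2.eq_iff.1 h with ⟨rfl, rfl⟩ | ⟨rfl, rfl⟩
  · exact ⟨3 * k, 3 * k + 2, by push_cast; rfl, by push_cast; rfl, by omega, by omega⟩
  · exact ⟨3 * k + 2, 3 * k, by push_cast; rfl, by push_cast; rfl, by omega, by omega⟩
  · exact ⟨3 * k + 1, 3 * k + 2, by push_cast; rfl, by push_cast; rfl, by omega, by omega⟩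
  · exact ⟨3 * k + 2, 3 * k + 1, by push_cast; rfl, by push_cast; rfl, by omega, by omega⟩
  · exact ⟨3 * k + 1, 3 * k + 3, by push_cast; rfl, by push_cast; rfl, by omega, by omega⟩
  · exact ⟨3 * k + 3, 3 * k + 1, by push_cast; rfl, by push_cast; rfl, by omega, by omega⟩

/-- The ends of a triadic interval separate its interior from the rest of the whirl graph. -/
theorem whirlGraph_mem_Icc {u w : ℚ} (h : whirlGraph.Adj u w) {k : ℕ} {c : ℤ}
    (h1 : (c : ℚ) / 3 ^ k < u) (h2 : u < (c + 1 : ℚ) / 3 ^ k) :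
    (c : ℚ) / 3 ^ k ≤ w ∧ w ≤ (c + 1 : ℚ) / 3 ^ k := by
  obtain ⟨m, t, a, b, rfl, rfl, -, hab⟩ := whirlGraph_adj h
  rcases lt_or_ge m k with hm | hm
  · obtain ⟨r, rfl⟩ := Nat.exists_eq_add_of_lt hm
    have hp : (3 : ℚ) ^ (m + r + 1) = 3 ^ (m + 1) * 3 ^ r := by ring
    have e : (a : ℚ) / 3 ^ (m + 1) = (a * 3 ^ r : ℤ) / 3 ^ (m + r + 1) := by
      rw [hp]; push_cast; field_simp
    rw [e, div_lt_div_iff_of_pos_right (by positivity)] at h1 h2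
    have h1' : c < a * 3 ^ r := by exact_mod_cast h1
    have h2' : (a * 3 ^ r : ℤ) < c + 1 := by exact_mod_cast h2
    omega
  · obtain ⟨r, rfl⟩ := Nat.exists_eq_add_of_le hm
    have hp : (3 : ℚ) ^ (k + r + 1) = 3 ^ k * (3 * 3 ^ r) := by ring
    have e : ∀ z : ℤ, (z : ℚ) / 3 ^ k = (3 * (z * 3 ^ r) : ℤ) / 3 ^ (k + r + 1) := by
      intro z; rw [hp]; push_cast; field_simp
    have e1 : (c + 1 : ℚ) = ((c + 1 : ℤ) : ℚ) := by push_cast; rfl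
    rw [e1] at h2 ⊢
    rw [e, div_lt_div_iff_of_pos_right (by positivity)] at h1 h2
    rw [e, e, div_le_div_iff_of_pos_right (by positivity),
      div_le_div_iff_of_pos_right (by positivity)]
    have h1' : 3 * (c * 3 ^ r) < (a : ℤ) := by exact_mod_cast h1
    have h2' : (a : ℤ) < 3 * ((c + 1) * 3 ^ r) := by exact_mod_cast h2
    have : 3 * (c * 3 ^ r) ≤ (b : ℤ) ∧ (b : ℤ) ≤ 3 * ((c + 1) * 3 ^ r) := by omega
    exact_mod_cast this

/-- A neighbour of a triadic rational of level `n` is of level `n` itself, or joined to it by an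
edge of a finer level, which has length `2 / 3 ^ m`. -/
theorem whirlGraph_adj_triadic {j n : ℕ} {w : ℚ} (h : whirlGraph.Adj (j / 3 ^ n) w) :
    (∃ c : ℕ, c ≤ 3 ^ n ∧ w = c / 3 ^ n) ∨
      ∃ m, n < m ∧ (w = j / 3 ^ n + 2 / 3 ^ m ∨ w = j / 3 ^ n - 2 / 3 ^ m) := by
  obtain ⟨m, t, a, b, ha, rfl, hb, hab⟩ := whirlGraph_adj h
  rcases lt_or_ge m n with hm | hm
  · obtain ⟨r, rfl⟩ := Nat.exists_eq_add_of_lt hm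
    refine .inl ⟨b * 3 ^ r, ?_, ?_⟩
    · calc b * 3 ^ r ≤ 3 ^ (m + 1) * 3 ^ r := Nat.mul_le_mul_right _ hb
        _ = 3 ^ (m + r + 1) := by ring
    · have hp : (3 : ℚ) ^ (m + r + 1) = 3 ^ (m + 1) * 3 ^ r := by ring
      rw [hp]; push_cast; field_simp
  · obtain ⟨r, rfl⟩ := Nat.exists_eq_add_of_le hm
    have hp : (3 : ℚ) ^ (n + r + 1) = 3 ^ n * (3 * 3 ^ r) := by ring
    have e : (j : ℚ) / 3 ^ n = (3 * (j * 3 ^ r) : ℕ) / 3 ^ (n + r + 1) := by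
      rw [hp]; push_cast; field_simp
    rw [e] at ha ⊢
    rw [div_left_inj' (by positivity)] at ha
    have ha' : 3 * (j * 3 ^ r) = a := by exact_mod_cast ha
    rw [ha']
    refine .inr ⟨n + r + 1, by omega, ?_⟩
    have : b = a + 2 ∨ a = b + 2 := by omega
    rcases this with rfl | rfl
    · left; push_cast; ring
    · right; push_cast; ring

/-! ### The Farey graph is not a topological minor of the whirl graph -/

/-- Distance from the triadic rational `x`, counted positively in the direction `σ = ±1`. -/
def orientedDist (σ : ℤ) (x : ℚ) (v : whirlGraph.verts) : ℚ := σ * (v - x)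

theorem triadicSeparated_orientedDist {σ : ℤ} (hσ : σ = 1 ∨ σ = -1) (j n : ℕ) :
    TriadicSeparated whirlGraph.coe (orientedDist σ (j / 3 ^ n)) n := by
  intro k hk c u w huw h1 h2
  obtain ⟨r, rfl⟩ := Nat.exists_eq_add_of_le hk
  have e : (j : ℚ) / 3 ^ n = (j * 3 ^ r) / 3 ^ (n + r) := by rw [pow_add]; field_simp
  have huw' : whirlGraph.Adj u w := huw
  simp only [orientedDist, e] at h1 h2 ⊢
  rcases hσ with rfl | rfl
  · have := whirlGraph_mem_Icc huw' (k := n + r) (c := c + j * 3 ^ r)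
      (by push_cast at h1 ⊢; rw [add_div]; linarith)
      (by push_cast at h2 ⊢; rw [add_right_comm, add_div]; linarith)
    push_cast at this ⊢
    rw [add_right_comm, add_div, add_div _ ((j : ℚ) * 3 ^ r)] at this
    constructor <;> linarith [this.1, this.2]
  · have := whirlGraph_mem_Icc huw' (k := n + r) (c := j * 3 ^ r - (c + 1))
      (by push_cast at h2 ⊢; rw [sub_div]; linarith)
      (by
        push_cast at h1 ⊢
        rw [show (j : ℚ) * 3 ^ r - (c + 1) + 1 = j * 3 ^ r - c by ring, sub_div]; linarith)
    push_cast at this ⊢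
    rw [show (j : ℚ) * 3 ^ r - (c + 1) + 1 = j * 3 ^ r - c by ring, sub_div, sub_div] at this
    constructor <;> linarith [this.1, this.2]

theorem orientedDist_injective {σ : ℤ} (hσ : σ = 1 ∨ σ = -1) (x : ℚ) :
    Function.Injective (orientedDist σ x) := by
  intro u v h
  rw [orientedDist, orientedDist] at h
  apply Subtype.ext
  rcases hσ with rfl | rfl <;> push_cast at h <;> linarith

/-- A vertex of the whirl graph has infinitely many neighbours only by having neighbours at the
distances `2 / 3 ^ m` for arbitrarily large `m`, so the spokes accumulate at the centre from at
least one of the two sides. -/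
theorem whirlGraph_isEmpty_fanSubdivision : IsEmpty (FanSubdivision whirlGraph.coe) := by
  refine ⟨fun F => ?_⟩
  obtain ⟨n, -, j, -, hX⟩ := F.center.2
  have hfirst : Function.Injective F.first := by
    intro i i' h
    by_contra hii
    exact F.spoke_spoke i i' hii _ (F.spoke i).start_mem_support
      (by rw [h]; exact (F.spoke i').start_mem_support)
  have hadj : ∀ i, whirlGraph.Adj F.center (F.first i) := F.adj_first
  have key : ∀ N, ∃ i m, N < m ∧ ((F.first i : ℚ) = F.center + 2 / 3 ^ m ∨
      (F.first i : ℚ) = F.center - 2 / 3 ^ m) := by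
    intro N
    by_contra! hN
    have hX' : (F.center : ℚ) = (j * 3 ^ N : ℕ) / 3 ^ (n + N) := by
      rw [hX, pow_add]; push_cast; field_simp
    have hfin : {q : ℚ | ∃ c : ℕ, c ≤ 3 ^ (n + N) ∧ q = c / 3 ^ (n + N)}.Finite := by
      refine ((Set.finite_Iic (3 ^ (n + N))).image fun c : ℕ => (c : ℚ) / 3 ^ (n + N)).subset ?_
      rintro q ⟨c, hc, rfl⟩
      exact ⟨c, hc, rfl⟩
    refine Set.not_injOn_infinite_finite_image Set.infinite_univ
      (f := fun i => (F.first i : ℚ)) (hfin.subset ?_)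
      (fun i _ i' _ h => hfirst (Subtype.ext h))
    rintro q ⟨i, -, rfl⟩
    have hi := hadj i
    rw [hX'] at hi
    rcases whirlGraph_adj_triadic hi with h | ⟨m, hm, h⟩
    · exact h
    · rw [← hX'] at h
      exact absurd h (by
        have := hN i m (by omega)
        tauto)
  obtain ⟨σ, hσ, hinf⟩ : ∃ σ : ℤ, (σ = 1 ∨ σ = -1) ∧
      ∀ N, ∃ i m, N < m ∧ orientedDist σ (j / 3 ^ n) (F.first i) = 2 / 3 ^ m := by
    by_contra! h
    obtain ⟨N₁, h₁⟩ := h 1 (.inl rfl)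
    obtain ⟨N₂, h₂⟩ := h (-1) (.inr rfl)
    obtain ⟨i, m, hm, hi | hi⟩ := key (max N₁ N₂)
    · refine h₁ i m (by omega) ?_
      rw [orientedDist, hi, hX]; push_cast; ring
    · refine h₂ i m (by omega) ?_
      rw [orientedDist, hi, hX]; push_cast; ring
  refine F.false_of_triadicSeparated (triadicSeparated_orientedDist hσ j n)
    (orientedDist_injective hσ _) (by rw [orientedDist, hX, sub_self, mul_zero]) ?_ hinf
  intro w hw h0 h1
  have hw' : whirlGraph.Adj F.center w := hw
  rw [hX] at hw'
  rw [orientedDist] at h0 h1 ⊢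
  rcases whirlGraph_adj_triadic hw' with ⟨c, -, hc⟩ | ⟨m, -, hm⟩
  · rw [hc, show (σ : ℚ) * ((c : ℚ) / 3 ^ n - j / 3 ^ n) = (σ * (c - j) : ℤ) / 3 ^ n by
      push_cast; ring] at h0 h1
    rw [div_lt_div_iff_of_pos_right (by positivity)] at h1
    rw [div_pos_iff_of_pos_right (by positivity)] at h0
    have h0' : 0 < σ * (c - j) := by exact_mod_cast h0
    have h1' : σ * (c - j) < 1 := by exact_mod_cast h1
    omega
  · refine ⟨m, ?_⟩
    have hpos : (0 : ℚ) < 2 / 3 ^ m := by positivity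
    rcases hm with hm | hm <;> rcases hσ with rfl | rfl <;> rw [hm] at h0 ⊢ <;>
      push_cast at h0 ⊢ <;> linarith

theorem whirlGraph_not_isTopologicalMinor : ¬ IsTopologicalMinor fareyGraph whirlGraph.coe :=
  fun ⟨S⟩ => whirlGraph_isEmpty_fanSubdivision.false S.fan

/-! ### Positions of the branch sets -/

/-- The left end of the Cantor interval that belongs to a word `e` is `wordNum e / 3 ^ e.length`,
so the base 3 digits of `wordNum e` are `0` for `false` and `2` for `true`, with the first letter
of the word as the last digit. -/
def wordNum : List Bool → ℕ
  | [] => 0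
  | false :: e => 3 * wordNum e
  | true :: e => 3 * wordNum e + 2

/-- The interval of the word `e`, mapped into `[3/9, 4/9]` or `[5/9, 6/9]` by `π₁` or `π₂`, is
`[K / 3 ^ (e.length + 2), (K + 1) / 3 ^ (e.length + 2)]` with `K = copyNum i e`. -/
def copyNum (i : Bool) (e : List Bool) : ℕ := (bif i then 5 else 3) * 3 ^ e.length + wordNum e

/-- The smaller element of the branch set of a vertex of the Farey graph. -/
def branchLo : FareyVertex → ℚ
  | .x => 3 / 9
  | .y => 4 / 9
  | .new i e => (3 * copyNum i e + 1) / 3 ^ (e.length + 3)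

/-- The larger element of the branch set of a vertex of the Farey graph. -/
def branchHi : FareyVertex → ℚ
  | .x => 5 / 9
  | .y => 6 / 9
  | .new i e => (3 * copyNum i e + 2) / 3 ^ (e.length + 3)

/-- The branch set of a vertex of the Farey graph. -/
def branchPair (v : FareyVertex) : Set ℚ := {branchLo v, branchHi v}

theorem branchLo_mem (v : FareyVertex) : branchLo v ∈ branchPair v := .inl rfl

theorem branchHi_mem (v : FareyVertex) : branchHi v ∈ branchPair v := .inr rfl

theorem wordNum_lt (e : List Bool) : wordNum e < 3 ^ e.length := by
  induction e with
  | nil => simp [wordNum]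
  | cons b e ih =>
    rw [List.length_cons, pow_succ]
    cases b <;> simp only [wordNum] <;> omega

theorem wordNum_injective {e f : List Bool} (hl : e.length = f.length)
    (h : wordNum e = wordNum f) : e = f := by
  induction e generalizing f with
  | nil => exact (List.length_eq_zero_iff.1 hl.symm).symm
  | cons b e ih =>
    rcases f with _ | ⟨c, f⟩
    · simp at hl
    have hl' : e.length = f.length := by simpa using hl
    have key : b = c ∧ wordNum e = wordNum f := by
      cases b <;> cases c <;> simp only [wordNum] at h <;> first | omega | exact ⟨rfl, by omega⟩
    rw [key.1, ih hl' key.2]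

theorem copyNum_lt (i : Bool) (e : List Bool) : copyNum i e < 3 ^ (e.length + 2) := by
  have := wordNum_lt e
  have h9 : 3 ^ (e.length + 2) = 9 * 3 ^ e.length := by ring
  cases i <;> simp only [copyNum, cond_true, cond_false] <;> omega

theorem copyNum_injective {i j : Bool} {e f : List Bool} (hl : e.length = f.length)
    (h : copyNum i e = copyNum j f) : i = j ∧ e = f := by
  have h1 := wordNum_lt e
  have h2 := wordNum_lt f
  have key : i = j ∧ wordNum e = wordNum f := by
    rw [copyNum, copyNum, hl] at h
    rw [hl] at h1
    cases i <;> cases j <;> simp only [cond_true, cond_false] at h <;>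
      first | omega | exact ⟨rfl, by omega⟩
  exact ⟨key.1, wordNum_injective hl key.2⟩

/-- A fraction in lowest terms with a power of three as denominator has unique numerator and
exponent. -/
theorem div_three_pow_inj {a b m n : ℕ} (ha : a % 3 ≠ 0) (hb : b % 3 ≠ 0)
    (h : (a : ℚ) / 3 ^ m = b / 3 ^ n) : a = b ∧ m = n := by
  have key : ∀ {a b m n : ℕ}, b % 3 ≠ 0 → (a : ℚ) / 3 ^ m = b / 3 ^ n → n ≤ m := by
    intro a b m n hb h
    by_contra! hlt
    obtain ⟨r, rfl⟩ := Nat.exists_eq_add_of_lt hlt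
    rw [show (3 : ℚ) ^ (m + r + 1) = 3 ^ m * (3 * 3 ^ r) by ring] at h
    field_simp at h
    have h' : a * 3 * 3 ^ r = b := by exact_mod_cast h
    apply hb
    rw [← h', mul_right_comm]
    exact Nat.mul_mod_left _ _
  obtain rfl := le_antisymm (key ha h.symm) (key hb h)
  rw [div_left_inj' (by positivity)] at h
  exact ⟨by exact_mod_cast h, rfl⟩

theorem new_ne_ninth {a b n : ℕ} (ha : a % 3 ≠ 0) : (a : ℚ) / 3 ^ (n + 3) ≠ b / 9 := by
  intro h
  rw [show (3 : ℚ) ^ (n + 3) = 9 * (3 * 3 ^ n) by ring] at h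
  field_simp at h
  have h' : a = 3 * 3 ^ n * b := by exact_mod_cast h
  apply ha
  rw [h', mul_assoc]
  exact Nat.mul_mod_right _ _

theorem mem_branchPair_new {p : ℚ} {i : Bool} {e : List Bool} : p ∈ branchPair (.new i e) ↔
    ∃ c : ℕ, (c = 1 ∨ c = 2) ∧ p = (3 * copyNum i e + c : ℕ) / 3 ^ (e.length + 3) := by
  simp [branchPair, branchLo, branchHi]

theorem mem_branchPair_x {p : ℚ} : p ∈ branchPair .x ↔
    ∃ c : ℕ, (c = 3 ∨ c = 5) ∧ p = c / 9 := by
  simp [branchPair, branchLo, branchHi]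

theorem mem_branchPair_y {p : ℚ} : p ∈ branchPair .y ↔
    ∃ c : ℕ, (c = 4 ∨ c = 6) ∧ p = c / 9 := by
  simp [branchPair, branchLo, branchHi]

/-- The branch sets are pairwise disjoint. -/
theorem branchPair_unique {p : ℚ} {u v : FareyVertex} (hu : p ∈ branchPair u)
    (hv : p ∈ branchPair v) : u = v := by
  have ninth : ∀ {a b : ℕ}, (a : ℚ) / 9 = b / 9 → a = b := by
    intro a b h
    rw [div_left_inj' (by norm_num)] at h
    exact_mod_cast h
  rcases u with _ | _ | ⟨i, e⟩ <;> rcases v with _ | _ | ⟨j, f⟩ <;>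
    simp only [mem_branchPair_x, mem_branchPair_y, mem_branchPair_new] at hu hv <;>
    obtain ⟨a, ha, rfl⟩ := hu <;> obtain ⟨b, hb, h⟩ := hv
  · rfl
  · have := ninth h; omega
  · exact absurd h.symm (new_ne_ninth (by omega))
  · have := ninth h; omega
  · rfl
  · exact absurd h.symm (new_ne_ninth (by omega))
  · exact absurd h (new_ne_ninth (by omega))
  · exact absurd h (new_ne_ninth (by omega))
  · obtain ⟨h1, h2⟩ := div_three_pow_inj (by omega) (by omega) h
    obtain ⟨rfl, rfl⟩ := copyNum_injective (i := i) (j := j) (e := e) (f := f) (by omega) (by omega)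
    rfl

theorem branchLo_ne_branchHi (v : FareyVertex) : branchLo v ≠ branchHi v := by
  rcases v with _ | _ | ⟨i, e⟩
  · norm_num [branchLo, branchHi]
  · norm_num [branchLo, branchHi]
  · simp only [branchLo, branchHi]
    rw [Ne, div_left_inj' (by positivity)]
    intro h
    linarith

/-! ### Cantor intervals and blue edges -/

/-- The maps `π₁` and `π₂`, indexed by the copies of the halved Farey graph. -/
def copyPerm (i : Bool) : Equiv.Perm ℚ := bif i then perm₂ else perm₁

theorem mem_cantorIntervals {n : ℕ} {I : ℚ × ℚ} : I ∈ cantorIntervals n ↔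
    ∃ e : List Bool, e.length = n ∧ I = ((wordNum e : ℚ) / 3 ^ e.length, 1 / 3 ^ e.length) := by
  induction n generalizing I with
  | zero =>
    simp only [cantorIntervals, Set.mem_singleton_iff, List.length_eq_zero_iff]
    constructor
    · rintro rfl
      exact ⟨[], rfl, by simp [wordNum]⟩
    · rintro ⟨_, rfl, rfl⟩
      simp [wordNum]
  | succ n ih =>
    have h0 : ∀ e : List Bool, ((wordNum (false :: e) : ℚ) / 3 ^ (false :: e).length,
        (1 : ℚ) / 3 ^ (false :: e).length) =
        ((wordNum e : ℚ) / 3 ^ e.length, 1 / 3 ^ e.length / 3) := by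
      intro e
      rw [List.length_cons, pow_succ, wordNum, Prod.mk.injEq]
      push_cast
      constructor <;> field_simp
    have h1 : ∀ e : List Bool, ((wordNum (true :: e) : ℚ) / 3 ^ (true :: e).length,
        (1 : ℚ) / 3 ^ (true :: e).length) =
        ((wordNum e : ℚ) / 3 ^ e.length + 2 / 3 * (1 / 3 ^ e.length),
          1 / 3 ^ e.length / 3) := by
      intro e
      rw [List.length_cons, pow_succ, wordNum, Prod.mk.injEq]
      push_cast
      constructor <;> field_simp
    constructor
    · rintro ⟨J, hJ, h⟩
      obtain ⟨e, rfl, rfl⟩ := ih.1 hJ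
      rcases h with rfl | rfl
      · exact ⟨false :: e, rfl, (h0 e).symm⟩
      · exact ⟨true :: e, rfl, (h1 e).symm⟩
    · rintro ⟨_ | ⟨b, e⟩, he, rfl⟩
      · simp at he
      refine ⟨_, ih.2 ⟨e, by simpa using he, rfl⟩, ?_⟩
      cases b
      · exact .inl (h0 e)
      · exact .inr (h1 e)

theorem copyPerm_apply (i : Bool) (e : List Bool) (c : ℚ) :
    copyPerm i ((wordNum e : ℚ) / 3 ^ e.length + c / 3 * (1 / 3 ^ e.length)) =
      (3 * copyNum i e + c) / 3 ^ (e.length + 3) := by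
  have h : (3 : ℚ) ^ (e.length + 3) = 27 * 3 ^ e.length := by ring
  have h' : ∀ q, copyPerm i q = 1 / 9 * q + (bif i then 5 else 3) / 9 := by
    cases i <;> intro <;> rfl
  rw [h, h']
  cases i <;> simp only [copyNum, cond_false, cond_true] <;> push_cast <;> field_simp <;> ring

/-- The left and right end of the interval of a word lie in the branch sets of the two ends of
the blue edge of that word. -/
theorem ends_mem_branchPair (i : Bool) (e : List Bool) :
    (3 * copyNum i e : ℚ) / 3 ^ (e.length + 3) ∈ branchPair (fareyCopy i (blueEnds e).1) ∧
    (3 * copyNum i e + 3 : ℚ) / 3 ^ (e.length + 3) ∈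
      branchPair (fareyCopy i (blueEnds e).2) := by
  induction e with
  | nil =>
    cases i <;> simp [copyNum, wordNum, blueEnds, fareyCopy, branchPair, branchLo, branchHi] <;>
      norm_num
  | cons b e ih =>
    have h1 : (copyNum i (false :: e) : ℚ) = 3 * copyNum i e := by
      simp only [copyNum, wordNum, List.length_cons]; push_cast; ring
    have h2 : (copyNum i (true :: e) : ℚ) = 3 * copyNum i e + 2 := by
      simp only [copyNum, wordNum, List.length_cons]; push_cast; ring
    cases b
    · rw [h1, List.length_cons]
      constructor
      · change _ ∈ branchPair (fareyCopy i (blueEnds e).1)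
        convert ih.1 using 1
        field_simp; ring
      · refine .inl ?_
        change _ = (_ : ℚ) / _
        field_simp; ring
    · rw [h2, List.length_cons]
      constructor
      · refine .inr ?_
        change _ = (_ : ℚ) / _
        field_simp; ring
      · change _ ∈ branchPair (fareyCopy i (blueEnds e).2)
        convert ih.2 using 1
        field_simp; ring

/-- The edge of `whirlFareySubgraph` that corresponds to the blue edge of the word `w` in the
`i`-th copy of the halved Farey graph. -/
def linkEdge (i : Bool) : List Bool → Sym2 ℚ
  | [] => s(3 / 9, 6 / 9)
  | false :: e => s((3 * copyNum i e : ℚ) / 3 ^ (e.length + 3), branchHi (.new i e))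
  | true :: e => s(branchLo (.new i e), (3 * copyNum i e + 3 : ℚ) / 3 ^ (e.length + 3))

theorem linkEdge_ends (i : Bool) (w : List Bool) : ∃ p q, linkEdge i w = s(p, q) ∧
    p ∈ branchPair (fareyCopy i (blueEnds w).1) ∧
    q ∈ branchPair (fareyCopy i (blueEnds w).2) := by
  rcases w with _ | ⟨_ | _, e⟩
  · exact ⟨_, _, rfl, .inl rfl, .inr rfl⟩
  · exact ⟨_, _, rfl, (ends_mem_branchPair i e).1, .inr rfl⟩
  · exact ⟨_, _, rfl, .inl rfl, (ends_mem_branchPair i e).2⟩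

/-! ### The edges of the subgraph `H` -/

theorem starGraph_verts {q : ℚ} : q ∈ starGraph.verts ↔ ∃ e : List Bool, ∃ c : ℚ,
    (c = 0 ∨ c = 1 ∨ c = 2 ∨ c = 3) ∧
      q = (wordNum e : ℚ) / 3 ^ e.length + c / 3 * (1 / 3 ^ e.length) := by
  constructor
  · rintro ⟨n, hn, I, hI, h⟩
    obtain ⟨e, -, rfl⟩ := mem_cantorIntervals.1 hI
    rcases h with rfl | rfl | rfl | rfl
    · exact ⟨e, 0, by simp, by simp⟩
    · exact ⟨e, 1, by simp, rfl⟩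
    · exact ⟨e, 2, by simp, rfl⟩
    · exact ⟨e, 3, by simp, by norm_num⟩
  · rintro ⟨e, c, hc, rfl⟩
    refine ⟨e.length + 1, by omega, _, mem_cantorIntervals.2 ⟨e, rfl, rfl⟩, ?_⟩
    rcases hc with rfl | rfl | rfl | rfl <;> norm_num

theorem starGraph_adj {u v : ℚ} : starGraph.Adj u v ↔ ∃ e : List Bool, ∃ a b : ℚ,
    (a = 0 ∧ b = 2 ∨ a = 1 ∧ b = 2 ∨ a = 1 ∧ b = 3) ∧
      s(u, v) = s((wordNum e : ℚ) / 3 ^ e.length + a / 3 * (1 / 3 ^ e.length),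
        (wordNum e : ℚ) / 3 ^ e.length + b / 3 * (1 / 3 ^ e.length)) := by
  constructor
  · rintro ⟨-, -, -, n, hn, I, hI, h⟩
    obtain ⟨e, -, rfl⟩ := mem_cantorIntervals.1 hI
    rcases h with h | h | h
    · exact ⟨e, 0, 2, by simp, by simpa using h⟩
    · exact ⟨e, 1, 2, by simp, h⟩
    · exact ⟨e, 1, 3, by simp, by simpa using h⟩
  · rintro ⟨e, a, b, hab, h⟩
    have hE : s(u, v) ∈ {e | ∃ n, 1 ≤ n ∧ e ∈ starEdges n} := by
      refine ⟨e.length + 1, by omega, _, mem_cantorIntervals.2 ⟨e, rfl, rfl⟩, ?_⟩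
      rcases hab with ⟨rfl, rfl⟩ | ⟨rfl, rfl⟩ | ⟨rfl, rfl⟩ <;> rw [h] <;> norm_num
    have ha := starGraph_verts.2 ⟨e, a, by tauto, rfl⟩
    have hb := starGraph_verts.2 ⟨e, b, by tauto, rfl⟩
    have hne : (wordNum e : ℚ) / 3 ^ e.length + a / 3 * (1 / 3 ^ e.length) ≠
        (wordNum e : ℚ) / 3 ^ e.length + b / 3 * (1 / 3 ^ e.length) := by
      rw [Ne, add_right_inj, mul_left_inj' (by positivity)]
      rcases hab with ⟨rfl, rfl⟩ | ⟨rfl, rfl⟩ | ⟨rfl, rfl⟩ <;> norm_num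
    rcases Sym2.eq_iff.1 h with ⟨rfl, rfl⟩ | ⟨rfl, rfl⟩
    · exact ⟨ha, hb, hne, hE⟩
    · exact ⟨hb, ha, hne.symm, hE⟩

theorem permGraph_copyPerm_adj {i : Bool} {u v : ℚ} :
    (permGraph (copyPerm i) starGraph).Adj u v ↔ ∃ e : List Bool,
      s(u, v) = s(branchLo (.new i e), branchHi (.new i e)) ∨
        s(u, v) = linkEdge i (false :: e) ∨ s(u, v) = linkEdge i (true :: e) := by
  have key : (permGraph (copyPerm i) starGraph).Adj u v ↔ ∃ e : List Bool, ∃ a b : ℚ,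
      (a = 0 ∧ b = 2 ∨ a = 1 ∧ b = 2 ∨ a = 1 ∧ b = 3) ∧
        s(u, v) = s((3 * copyNum i e + a) / 3 ^ (e.length + 3),
          (3 * copyNum i e + b) / 3 ^ (e.length + 3)) := by
    constructor
    · rintro ⟨u', v', h, rfl, rfl⟩
      obtain ⟨e, a, b, hab, h⟩ := starGraph_adj.1 h
      refine ⟨e, a, b, hab, ?_⟩
      rw [← copyPerm_apply, ← copyPerm_apply]
      exact congrArg (Sym2.map (copyPerm i)) h
    · rintro ⟨e, a, b, hab, h⟩
      refine ⟨(copyPerm i).symm u, (copyPerm i).symm v, starGraph_adj.2 ⟨e, a, b, hab, ?_⟩,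
        (copyPerm i).apply_symm_apply u, (copyPerm i).apply_symm_apply v⟩
      rw [← copyPerm_apply, ← copyPerm_apply] at h
      simpa using congrArg (Sym2.map (copyPerm i).symm) h
  rw [key]
  constructor
  · rintro ⟨e, a, b, ⟨rfl, rfl⟩ | ⟨rfl, rfl⟩ | ⟨rfl, rfl⟩, h⟩
    · exact ⟨e, .inr (.inl (by rw [h, add_zero]; rfl))⟩
    · exact ⟨e, .inl h⟩
    · exact ⟨e, .inr (.inr h)⟩
  · rintro ⟨e, h | h | h⟩
    · exact ⟨e, 1, 2, by simp, h⟩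
    · exact ⟨e, 0, 2, by simp, by rw [h, add_zero]; rfl⟩
    · exact ⟨e, 1, 3, by simp, h⟩

theorem whirlFareySubgraph_verts {p : ℚ} :
    p ∈ whirlFareySubgraph.verts ↔ ∃ v, p ∈ branchPair v := by
  have key : p ∈ whirlFareySubgraph.verts ↔ ∃ i : Bool, ∃ q ∈ starGraph.verts,
      copyPerm i q = p := by
    rw [Bool.exists_bool]; rfl
  rw [key]
  constructor
  · rintro ⟨i, q, hq, rfl⟩
    obtain ⟨e, c, hc, rfl⟩ := starGraph_verts.1 hq
    rw [copyPerm_apply]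
    rcases hc with rfl | rfl | rfl | rfl
    · exact ⟨_, by simpa using (ends_mem_branchPair i e).1⟩
    · exact ⟨_, branchLo_mem (.new i e)⟩
    · exact ⟨_, branchHi_mem (.new i e)⟩
    · exact ⟨_, (ends_mem_branchPair i e).2⟩
  · have hc : ∀ (i : Bool) (e : List Bool) (c : ℚ), (c = 0 ∨ c = 1 ∨ c = 2 ∨ c = 3) →
        ∃ q ∈ starGraph.verts, copyPerm i q = (3 * copyNum i e + c) / 3 ^ (e.length + 3) :=
      fun i e c h => ⟨_, starGraph_verts.2 ⟨e, c, h, rfl⟩, copyPerm_apply i e c⟩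
    rintro ⟨_ | _ | ⟨i, e⟩, rfl | rfl⟩
    · obtain ⟨q, hq, h⟩ := hc false [] 0 (by simp)
      exact ⟨false, q, hq, h.trans (by norm_num [copyNum, wordNum, branchLo])⟩
    · obtain ⟨q, hq, h⟩ := hc true [] 0 (by simp)
      exact ⟨true, q, hq, h.trans (by norm_num [copyNum, wordNum, branchHi])⟩
    · obtain ⟨q, hq, h⟩ := hc false [] 3 (by simp)
      exact ⟨false, q, hq, h.trans (by norm_num [copyNum, wordNum, branchLo])⟩
    · obtain ⟨q, hq, h⟩ := hc true [] 3 (by simp)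
      exact ⟨true, q, hq, h.trans (by norm_num [copyNum, wordNum, branchHi])⟩
    · exact ⟨i, hc i e 1 (by simp)⟩
    · exact ⟨i, hc i e 2 (by simp)⟩

/-- The edges of `H` are the edges inside the branch sets and one edge for every blue edge. -/
theorem whirlFareySubgraph_adj {u v : ℚ} : whirlFareySubgraph.Adj u v ↔
    (∃ a, s(u, v) = s(branchLo a, branchHi a)) ∨ ∃ i w, s(u, v) = linkEdge i w := by
  constructor
  · rintro ⟨-, -, -, h | h⟩
    · have h' : ∃ i, (permGraph (copyPerm i) starGraph).Adj u v := by
        rw [Bool.exists_bool]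
        exact h
      obtain ⟨i, h'⟩ := h'
      obtain ⟨e, h | h | h⟩ := permGraph_copyPerm_adj.1 h'
      · exact .inl ⟨_, h⟩
      · exact .inr ⟨i, _, h⟩
      · exact .inr ⟨i, _, h⟩
    · rcases h with h | h | h
      · exact .inl ⟨.x, h⟩
      · exact .inl ⟨.y, h⟩
      · exact .inr ⟨false, [], h⟩
  · have hvert : ∀ {a p}, p ∈ branchPair a → p ∈ whirlFareySubgraph.verts :=
      fun h => whirlFareySubgraph_verts.2 ⟨_, h⟩
    have hcopy : ∀ i, (permGraph (copyPerm i) starGraph).Adj u v →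
        s(u, v) ∈ (permGraph perm₁ starGraph ⊔ permGraph perm₂ starGraph).edgeSet := by
      rintro (_ | _) h
      · exact .inl h
      · exact .inr h
    have hmk : ∀ {p q a b}, p ∈ branchPair a → q ∈ branchPair b → p ≠ q → s(u, v) = s(p, q) →
        s(u, v) ∈ (permGraph perm₁ starGraph ⊔ permGraph perm₂ starGraph).edgeSet ∪
          {s(3 / 9, 5 / 9), s(4 / 9, 6 / 9), s(3 / 9, 6 / 9)} →
        whirlFareySubgraph.Adj u v := by
      intro p q a b hp hq hne h hE
      rcases Sym2.eq_iff.1 h with ⟨rfl, rfl⟩ | ⟨rfl, rfl⟩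
      · exact ⟨hvert hp, hvert hq, hne, hE⟩
      · exact ⟨hvert hq, hvert hp, hne.symm, hE⟩
    rintro (⟨a, h⟩ | ⟨i, w, h⟩)
    · refine hmk (branchLo_mem a) (branchHi_mem a) (branchLo_ne_branchHi a) h ?_
      rcases a with _ | _ | ⟨i, e⟩
      · exact .inr (.inl h)
      · exact .inr (.inr (.inl h))
      · exact .inl (hcopy i (permGraph_copyPerm_adj.2 ⟨e, .inl h⟩))
    · obtain ⟨p, q, hpq, hp, hq⟩ := linkEdge_ends i w
      refine hmk hp hq ?_ (h.trans hpq) ?_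
      · rintro rfl
        exact (fareyCopy_injective i).ne (blueEnds_ne w) (branchPair_unique hp hq)
      · rcases w with _ | ⟨_ | _, e⟩
        · exact .inr (.inr (.inr h))
        · exact .inl (hcopy i (permGraph_copyPerm_adj.2 ⟨e, .inr (.inl h)⟩))
        · exact .inl (hcopy i (permGraph_copyPerm_adj.2 ⟨e, .inr (.inr h)⟩))

theorem mem_whirlFareyMatching {f : Sym2 ℚ} :
    f ∈ whirlFareyMatching ↔ ∃ a, f = s(branchLo a, branchHi a) := by
  have key : ∀ i, f ∈ permEdges (copyPerm i) starMatching ↔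
      ∃ e, f = s(branchLo (.new i e), branchHi (.new i e)) := by
    intro i
    constructor
    · rintro ⟨_, ⟨n, -, I, hI, rfl⟩, rfl⟩
      obtain ⟨e, -, rfl⟩ := mem_cantorIntervals.1 hI
      refine ⟨e, ?_⟩
      rw [Sym2.map_mk, copyPerm_apply, copyPerm_apply]
      rfl
    · rintro ⟨e, rfl⟩
      refine ⟨_, ⟨e.length + 1, by omega, _, mem_cantorIntervals.2 ⟨e, rfl, rfl⟩, rfl⟩, ?_⟩
      rw [Sym2.map_mk, copyPerm_apply, copyPerm_apply]
      rfl
  constructor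
  · rintro ((h | h) | h | h)
    · obtain ⟨e, h⟩ := (key false).1 h
      exact ⟨_, h⟩
    · obtain ⟨e, h⟩ := (key true).1 h
      exact ⟨_, h⟩
    · exact ⟨.x, h⟩
    · exact ⟨.y, h⟩
  · rintro ⟨_ | _ | ⟨_ | _, e⟩, h⟩
    · exact .inr (.inl h)
    · exact .inr (.inr h)
    · exact .inl (.inl ((key false).2 ⟨e, h⟩))
    · exact .inl (.inr ((key true).2 ⟨e, h⟩))

theorem mem_branchPair_iff {p : ℚ} {a : FareyVertex} :
    p ∈ branchPair a ↔ p ∈ s(branchLo a, branchHi a) := by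
  rw [Sym2.mem_iff]; rfl

theorem independentEdges_whirlFareyMatching : IndependentEdges whirlFareyMatching := by
  intro e he f hf hne v hve hvf
  obtain ⟨a, rfl⟩ := mem_whirlFareyMatching.1 he
  obtain ⟨b, rfl⟩ := mem_whirlFareyMatching.1 hf
  rw [← mem_branchPair_iff] at hve hvf
  rw [branchPair_unique hve hvf] at hne
  exact hne rfl

theorem whirlFareyMatching_subset : whirlFareyMatching ⊆ whirlFareySubgraph.edgeSet := by
  intro f hf
  obtain ⟨a, rfl⟩ := mem_whirlFareyMatching.1 hf
  exact whirlFareySubgraph_adj.2 (.inl ⟨a, rfl⟩)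

/-! ### `H` is a subgraph of the whirl graph -/

theorem mem_whirlGraph_verts {n k : ℕ} (h : k ≤ 3 ^ (n + 1)) :
    (k : ℚ) / 3 ^ (n + 1) ∈ whirlGraph.verts :=
  ⟨n + 1, by omega, k, h, rfl⟩

theorem whirlGraph_adj_of_lt {n k a b : ℕ} (hk : k < 3 ^ n)
    (hab : a = 0 ∧ b = 2 ∨ a = 1 ∧ b = 2 ∨ a = 1 ∧ b = 3) :
    whirlGraph.Adj ((3 * k + a : ℚ) / 3 ^ (n + 1)) ((3 * k + b : ℚ) / 3 ^ (n + 1)) := by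
  have hp : 3 ^ (n + 1) = 3 * 3 ^ n := pow_succ' _ _
  refine ⟨by exact_mod_cast mem_whirlGraph_verts (n := n) (k := 3 * k + a) (by omega),
    by exact_mod_cast mem_whirlGraph_verts (n := n) (k := 3 * k + b) (by omega), ?_,
    n + 1, by omega, k, hk, ?_⟩
  · rw [Ne, div_left_inj' (by positivity), add_right_inj, Nat.cast_inj]
    omega
  · rcases hab with ⟨rfl, rfl⟩ | ⟨rfl, rfl⟩ | ⟨rfl, rfl⟩ <;> simp

theorem whirlGraph_adj_branch (a : FareyVertex) : whirlGraph.Adj (branchLo a) (branchHi a) := by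
  rcases a with _ | _ | ⟨i, e⟩
  · have := whirlGraph_adj_of_lt (n := 1) (k := 1) (a := 0) (b := 2) (by norm_num) (by simp)
    norm_num [branchLo, branchHi] at this ⊢
    exact this
  · have := whirlGraph_adj_of_lt (n := 1) (k := 1) (a := 1) (b := 3) (by norm_num) (by simp)
    norm_num [branchLo, branchHi] at this ⊢
    exact this
  · have := whirlGraph_adj_of_lt (a := 1) (b := 2) (copyNum_lt i e) (by simp)
    rwa [Nat.cast_one, Nat.cast_ofNat] at this

theorem linkEdge_mem_whirlGraph (i : Bool) (w : List Bool) :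
    linkEdge i w ∈ whirlGraph.edgeSet := by
  rcases w with _ | ⟨_ | _, e⟩
  · have := whirlGraph_adj_of_lt (n := 0) (k := 0) (a := 1) (b := 2) (by norm_num) (by simp)
    change whirlGraph.Adj _ _
    norm_num at this ⊢
    exact this
  · have := whirlGraph_adj_of_lt (a := 0) (b := 2) (copyNum_lt i e) (by simp)
    rwa [Nat.cast_zero, add_zero, Nat.cast_ofNat] at this
  · have := whirlGraph_adj_of_lt (a := 1) (b := 3) (copyNum_lt i e) (by simp)
    rwa [Nat.cast_one, Nat.cast_ofNat] at this

theorem whirlFareySubgraph_le : whirlFareySubgraph ≤ whirlGraph := by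
  constructor
  · intro p hp
    obtain ⟨a, rfl | rfl⟩ := whirlFareySubgraph_verts.1 hp
    · exact (whirlGraph_adj_branch a).fst_mem
    · exact (whirlGraph_adj_branch a).snd_mem
  · intro u v h
    rw [← SimpleGraph.Subgraph.mem_edgeSet]
    rcases whirlFareySubgraph_adj.1 h with ⟨a, h⟩ | ⟨i, w, h⟩
    · rw [h]; exact whirlGraph_adj_branch a
    · rw [h]; exact linkEdge_mem_whirlGraph i w

/-! ### The contraction `H / D` is the Farey graph -/

theorem fareyGraph_adj_iff_exists_branchPair {a b : FareyVertex} : fareyGraph.Adj a b ↔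
    a ≠ b ∧ ∃ p ∈ branchPair a, ∃ q ∈ branchPair b, whirlFareySubgraph.Adj p q := by
  constructor
  · intro h
    refine ⟨h.ne, ?_⟩
    obtain ⟨i, w, h⟩ := fareyGraph_adj.1 h
    obtain ⟨p, q, hpq, hp, hq⟩ := linkEdge_ends i w
    have hadj := whirlFareySubgraph_adj.2 (.inr ⟨i, w, hpq.symm⟩)
    rcases Sym2.eq_iff.1 h with ⟨rfl, rfl⟩ | ⟨rfl, rfl⟩
    · exact ⟨p, hp, q, hq, hadj⟩
    · exact ⟨q, hq, p, hp, hadj.symm⟩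
  · rintro ⟨hne, p, hp, q, hq, h⟩
    rcases whirlFareySubgraph_adj.1 h with ⟨c, h⟩ | ⟨i, w, h⟩
    · have hpc : p ∈ branchPair c := mem_branchPair_iff.2 (h ▸ Sym2.mem_mk_left p q)
      have hqc : q ∈ branchPair c := mem_branchPair_iff.2 (h ▸ Sym2.mem_mk_right p q)
      exact absurd ((branchPair_unique hp hpc).trans (branchPair_unique hqc hq)) hne
    · obtain ⟨p', q', hpq, hp', hq'⟩ := linkEdge_ends i w
      refine fareyGraph_adj.2 ⟨i, w, ?_⟩
      rcases Sym2.eq_iff.1 (h.trans hpq) with ⟨rfl, rfl⟩ | ⟨rfl, rfl⟩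
      · rw [branchPair_unique hp hp', branchPair_unique hq hq']
      · rw [branchPair_unique hp hq', branchPair_unique hq hp', Sym2.eq_swap]

/-- The vertex of `H / D` that corresponds to a vertex of the Farey graph. -/
def fareyComponent (a : FareyVertex) :
    (contractedPart whirlFareySubgraph whirlFareyMatching).ConnectedComponent :=
  SimpleGraph.connectedComponentMk _ ⟨branchLo a, whirlFareySubgraph_verts.2 ⟨a, branchLo_mem a⟩⟩

theorem mem_branchPair_of_reachable {u v : whirlFareySubgraph.verts} {a : FareyVertex}
    (h : (contractedPart whirlFareySubgraph whirlFareyMatching).Reachable u v)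
    (hu : (u : ℚ) ∈ branchPair a) : (v : ℚ) ∈ branchPair a := by
  obtain ⟨p⟩ := h
  induction p with
  | nil => exact hu
  | cons h p ih =>
    refine ih ?_
    obtain ⟨c, hc⟩ := mem_whirlFareyMatching.1 h.2
    rw [branchPair_unique hu (mem_branchPair_iff.2 (hc ▸ Sym2.mem_mk_left _ _))]
    exact mem_branchPair_iff.2 (hc ▸ Sym2.mem_mk_right _ _)

theorem mem_fareyComponent_supp {a : FareyVertex} {u : whirlFareySubgraph.verts} :
    u ∈ (fareyComponent a).supp ↔ (u : ℚ) ∈ branchPair a := by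
  rw [SimpleGraph.ConnectedComponent.mem_supp_iff, fareyComponent,
    SimpleGraph.ConnectedComponent.eq]
  constructor
  · exact fun h => mem_branchPair_of_reachable h.symm (branchLo_mem a)
  · intro hu
    obtain ⟨u, hu'⟩ := u
    rcases hu with rfl | rfl
    · exact SimpleGraph.Reachable.refl _
    · refine SimpleGraph.Adj.reachable ⟨?_, ?_⟩
      · exact whirlFareySubgraph_adj.2 (.inl ⟨a, Sym2.eq_swap⟩)
      · exact mem_whirlFareyMatching.2 ⟨a, Sym2.eq_swap⟩

theorem fareyComponent_bijective : Function.Bijective fareyComponent := by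
  constructor
  · intro a b h
    have ha : (⟨branchLo a, whirlFareySubgraph_verts.2 ⟨a, branchLo_mem a⟩⟩ :
        whirlFareySubgraph.verts) ∈ (fareyComponent a).supp :=
      mem_fareyComponent_supp.2 (branchLo_mem a)
    rw [h] at ha
    exact branchPair_unique (branchLo_mem a) (mem_fareyComponent_supp.1 ha)
  · intro A
    induction A using SimpleGraph.ConnectedComponent.ind with
    | h u =>
      obtain ⟨a, ha⟩ := whirlFareySubgraph_verts.1 u.2
      exact ⟨a, (mem_fareyComponent_supp.2 ha).symm⟩

/-- The isomorphism between the Farey graph and `H / D`. -/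
noncomputable def fareyIso :
    fareyGraph ≃g contract whirlFareySubgraph whirlFareyMatching where
  toEquiv := Equiv.ofBijective fareyComponent fareyComponent_bijective
  map_rel_iff' := by
    intro a b
    rw [fareyGraph_adj_iff_exists_branchPair]
    change (fareyComponent a ≠ fareyComponent b ∧ _) ↔ _
    refine and_congr fareyComponent_bijective.1.ne_iff ⟨?_, ?_⟩
    · rintro ⟨u, hu, v, hv, h⟩
      exact ⟨u, mem_fareyComponent_supp.1 hu, v, mem_fareyComponent_supp.1 hv, h⟩
    · rintro ⟨p, hp, q, hq, h⟩
      exact ⟨⟨p, h.fst_mem⟩, mem_fareyComponent_supp.2 hp, ⟨q, h.snd_mem⟩,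
        mem_fareyComponent_supp.2 hq, h⟩

theorem ncard_preimage_branchPair {W : Set ℚ} {a : FareyVertex} (h : branchPair a ⊆ W) :
    {u : W | (u : ℚ) ∈ branchPair a}.ncard = 2 := by
  refine Set.ncard_eq_two.2 ⟨⟨_, h (branchLo_mem a)⟩, ⟨_, h (branchHi_mem a)⟩,
    fun h => branchLo_ne_branchHi a (congrArg Subtype.val h), ?_⟩
  ext ⟨u, hu⟩
  simp [branchPair]

theorem ncard_supp_eq_two
    (A : (contractedPart whirlFareySubgraph whirlFareyMatching).ConnectedComponent) :
    A.supp.ncard = 2 := by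
  obtain ⟨a, rfl⟩ := fareyComponent_bijective.2 A
  have h : (fareyComponent a).supp = {u : whirlFareySubgraph.verts | (u : ℚ) ∈ branchPair a} :=
    Set.ext fun u => mem_fareyComponent_supp
  rw [h]
  exact ncard_preimage_branchPair fun p hp => whirlFareySubgraph_verts.2 ⟨a, hp⟩

theorem branchPair_subset_whirlGraph (a : FareyVertex) : branchPair a ⊆ whirlGraph.verts :=
  fun _ hp => whirlFareySubgraph_le.1 (whirlFareySubgraph_verts.2 ⟨a, hp⟩)

theorem isMinorModel_branchPair : IsMinorModel fareyGraph whirlGraph.coe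
    fun a => {u : whirlGraph.verts | (u : ℚ) ∈ branchPair a} where
  connected a := by
    have hne : Nonempty {u : whirlGraph.verts | (u : ℚ) ∈ branchPair a} :=
      ⟨⟨_, branchPair_subset_whirlGraph a (branchLo_mem a)⟩, branchLo_mem a⟩
    refine ⟨?_⟩
    rintro ⟨⟨u, hu⟩, hua⟩ ⟨⟨v, hv⟩, hva⟩
    have hua' : u = branchLo a ∨ u = branchHi a := hua
    have hva' : v = branchLo a ∨ v = branchHi a := hva
    rcases hua' with rfl | rfl <;> rcases hva' with rfl | rfl
    · exact SimpleGraph.Reachable.refl _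
    · exact SimpleGraph.Adj.reachable (whirlGraph_adj_branch a)
    · exact SimpleGraph.Adj.reachable (whirlGraph_adj_branch a).symm
    · exact SimpleGraph.Reachable.refl _
  disjoint a b hab := Set.disjoint_left.2 fun _ ha hb => hab (branchPair_unique ha hb)
  adj a b h := by
    obtain ⟨-, p, hp, q, hq, h⟩ := fareyGraph_adj_iff_exists_branchPair.1 h
    exact ⟨⟨p, branchPair_subset_whirlGraph a hp⟩, hp, ⟨q, branchPair_subset_whirlGraph b hq⟩, hq,
      whirlFareySubgraph_le.2 h⟩

theorem theorem2 :
    -- the whirl graph contains the Farey graph as a minor with branch sets of size two ...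
    (∃ B : FareyVertex → Set whirlGraph.verts,
      IsMinorModel fareyGraph whirlGraph.coe B ∧ ∀ a, (B a).ncard = 2) ∧
    -- ... namely the following contraction minor of a subgraph, by an independent set of edges,
    (whirlFareySubgraph ≤ whirlGraph ∧
      whirlFareyMatching ⊆ whirlFareySubgraph.edgeSet ∧
      IndependentEdges whirlFareyMatching ∧
      (∀ A : (contractedPart whirlFareySubgraph whirlFareyMatching).ConnectedComponent,
        A.supp.ncard = 2) ∧
      Nonempty (fareyGraph ≃g contract whirlFareySubgraph whirlFareyMatching)) ∧
    -- but the whirl graph does not contain the Farey graph as a topological minor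
    ¬ IsTopologicalMinor fareyGraph whirlGraph.coe :=
  ⟨⟨_, isMinorModel_branchPair, fun a => ncard_preimage_branchPair
      (branchPair_subset_whirlGraph a)⟩,
    ⟨whirlFareySubgraph_le, whirlFareyMatching_subset, independentEdges_whirlFareyMatching,
      ncard_supp_eq_two, ⟨fareyIso⟩⟩,
    whirlGraph_not_isTopologicalMinor⟩
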